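/- For $p\in(0,1)$ and $(s,d)\in\{0,1\}\times\mathbb N_{\ge 2}$ let $A^p_{s,d}:[0,1]^2\to[0,1]^2$ be the affine map $A^p_{s,d}(z)=L^p_{s,d}\,z+v^p_{s,d}$, where $$L^p_{s,d}=\begin{pmatrix}p^{1-s}(1-p)^s&0\\0&(-1)^s\frac1{d(d-1)}\end{pmatrix},\qquad v^p_{s,d}=\begin{pmatrix}sp\\ \frac1{d-s}\end{pmatrix}.$$ For a finite non-empty set $J\subseteq\{0,1\}\times\mathbb N_{\ge2}$ let $$\mathcal F^p_J=\bigcup_{((s_n,d_n))_{n\ge1}\in J^{\mathbb N}}\ \bigcap_{k\ge 1}A^p_{s_1,d_1}\circ\cdots\circ A^p_{s_k,d_k}([0,1]^2)$$ be the limit set of the iterated function system $\{A^p_{s,d}:(s,d)\in J\}$. For a real $2\times2$ matrix $L$ with singular values $\alpha_1(L)\ge\alpha_2(L)$ put $\varphi^r(L)=\alpha_1(L)^r$ if $0<r\le1$, $\varphi^r(L)=\alpha_1(L)\,\alpha_2(L)^{r-1}$ if $1<r\le2$, and $\varphi^r(L)=|\det L|^{r/2}$ if $r>2$. The affinity dimension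 of $\{L^p_{s,d}:(s,d)\in J\}$ is $$d(L^p_{s,d}\mid (s,d)\in J)=\inf\Big\{r>0:\ \sum_{m\ge1}\ \sum_{(u_1,\dots,u_m)\in J^m}\varphi^r(L^p_{u_1}\cdots L^p_{u_m})<\infty\Big\}.$$ Let $\pi_1,\pi_2$ denote the projections to the first and the second coordinate. Let $J\subseteq\{0,1\}\times\mathbb N_{\ge2}$ be finite and suppose that either $\pi_2(J)\subseteq\mathbb N_{\ge3}$ and $\pi_1(J)=\{0,1\}$, or $\{(0,2),(1,2)\}\subseteq J$. Then for every $p\in(0,1)$ the box-counting dimension of $\mathcal F^p_J$ exists (that is, its lower and upper box-counting dimensions coincide) and $$\dim_B(\mathcal F^p_J)=\dim_P(\mathcal F^p_J)=d(L^p_{s,d}\mid(s,d)\in J),$$ where $\dim_P$ denotes the packing dimension. -/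

import Mathlib

open Set Filter Topology
open scoped ENNReal

noncomputable section

namespace SignedLuroth

/-- The smallest cardinality of a cover of `F` by sets of diameter at most `δ`. -/
def coverNumber {X : Type*} [MetricSpace X] (δ : ℝ) (F : Set X) : ℕ∞ :=
  ⨅ (C : Set (Set X)) (_ : F ⊆ ⋃₀ C)
    (_ : ∀ U ∈ C, Metric.ediam U ≤ ENNReal.ofReal δ), C.encard

/-- The quotient `log N_δ(F) / (-log δ)`, as an extended real number. -/
def boxQuotient {X : Type*} [MetricSpace X] (F : Set X) (δ : ℝ) : EReal :=
  ENNReal.log (coverNumber δ F : ℝ≥0∞) / ((-Real.log δ : ℝ) : EReal)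

/-- The lower box-counting dimension. -/
def lowerBoxDim {X : Type*} [MetricSpace X] (F : Set X) : EReal :=
  liminf (boxQuotient F) (𝓝[>] (0 : ℝ))

/-- The upper box-counting dimension. -/
def upperBoxDim {X : Type*} [MetricSpace X] (F : Set X) : EReal :=
  limsup (boxQuotient F) (𝓝[>] (0 : ℝ))

/-- `F` has box-counting dimension `t`: the lower and the upper box-counting dimensions of `F`
are both equal to `t`. -/
def HasBoxDim {X : Type*} [MetricSpace X] (F : Set X) (t : EReal) : Prop :=
  lowerBoxDim F = t ∧ upperBoxDim F = t

/-- A `δ`-packing of `F`: an at most countable collection of pairwise disjoint closed balls with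
centres in `F` and radii in `(0, δ]`. A ball is recorded as the pair (centre, radius). -/
def IsPacking {X : Type*} [MetricSpace X] (δ : ℝ) (F : Set X) (t : Set (X × ℝ)) : Prop :=
  t.Countable ∧ (∀ b ∈ t, b.1 ∈ F ∧ 0 < b.2 ∧ b.2 ≤ δ) ∧
    t.PairwiseDisjoint (fun b => Metric.closedBall b.1 b.2)

/-- The `s`-dimensional packing premeasure: the limit, as `δ` decreases to `0`, of the supremum of
`∑ (2 r)^s` over the `δ`-packings of `F` (which is non-decreasing in `δ`). -/
def packingPremeasure {X : Type*} [MetricSpace X] (s : ℝ) (F : Set X) : ℝ≥0∞ :=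
  ⨅ (δ : ℝ) (_ : 0 < δ), ⨆ (t : Set (X × ℝ)) (_ : IsPacking δ F t),
    ∑' b : t, ENNReal.ofReal (2 * (b : X × ℝ).2) ^ s

/-- The `s`-dimensional packing (outer) measure. -/
def packingMeasure {X : Type*} [MetricSpace X] (s : ℝ) (F : Set X) : ℝ≥0∞ :=
  ⨅ (E : ℕ → Set X) (_ : F ⊆ ⋃ i, E i), ∑' i, packingPremeasure s (E i)

/-- The packing dimension. -/
def packingDim {X : Type*} [MetricSpace X] (F : Set X) : EReal :=
  ⨅ (s : ℝ) (_ : 0 ≤ s) (_ : packingMeasure s F = 0), (s : EReal)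

/-- The `(i+1)`-th largest singular value of a square matrix, with multiplicity. -/
def singularValue {D : ℕ} (L : Matrix (Fin D) (Fin D) ℝ) (i : ℕ) : ℝ :=
  (Matrix.toEuclideanLin L).singularValues i

/-- The singular value function `φ^r(L)`, for `r > 0` and a matrix of size `D ≥ 1`: it is
`α₁ ⋯ α_{⌈r⌉-1} α_{⌈r⌉}^{r-⌈r⌉+1}` if `r ≤ D` and `|det L|^{r/D}` if `r > D`. -/
def singularValueFunction {D : ℕ} (r : ℝ) (L : Matrix (Fin D) (Fin D) ℝ) : ℝ :=
  if r ≤ (D : ℝ) then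
    (∏ i ∈ Finset.range (⌈r⌉₊ - 1), singularValue L i) *
      singularValue L (⌈r⌉₊ - 1) ^ (r - (⌈r⌉₊ : ℝ) + 1)
  else |L.det| ^ (r / (D : ℝ))

/-- The product `L_{u₁} ⋯ L_{u_m}` along a word `u` of length `m`. -/
def wordMatrix {I : Type*} {D : ℕ} (L : I → Matrix (Fin D) (Fin D) ℝ) {m : ℕ}
    (u : Fin m → I) : Matrix (Fin D) (Fin D) ℝ :=
  (List.ofFn fun k => L (u k)).prod

/-- The affinity dimension: the infimum of those `r > 0` for which the sum of `φ^r(L_u)` over all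
non-empty words `u` is finite. -/
def affinityDim {I : Type*} {D : ℕ} (L : I → Matrix (Fin D) (Fin D) ℝ) : EReal :=
  ⨅ (r : ℝ) (_ : 0 < r)
    (_ : ∑' m : ℕ, ∑' u : Fin (m + 1) → I,
      ENNReal.ofReal (singularValueFunction r (wordMatrix L u)) < ⊤), (r : EReal)

/-- The composition `f (ω 0) ∘ ⋯ ∘ f (ω (k-1))`. -/
def prefixMap {X I : Type*} (f : I → X → X) (ω : ℕ → I) : ℕ → X → X
  | 0 => id
  | k + 1 => prefixMap f ω k ∘ f (ω k)

/-- The limit set of the iterated function system `f` on `K`: the union, over the infinite words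
`ω`, of the intersections of the nested sets `f (ω 0) ∘ ⋯ ∘ f (ω (k-1)) (K)`. -/
def limitSet {X I : Type*} (f : I → X → X) (K : Set X) : Set X :=
  ⋃ ω : ℕ → I, ⋂ k : ℕ, prefixMap f ω k '' K

/-- The unit square `[0,1]²` in the Euclidean plane. -/
def unitSquare : Set (EuclideanSpace ℝ (Fin 2)) :=
  {z | ∀ i, z i ∈ Icc (0 : ℝ) 1}

/-- The linear part `L^p_{s,d}`, for a digit `e = (s, d)` with `s ∈ {0,1}` and `d ≥ 2`. -/
def linPart (p : ℝ) (e : ℕ × ℕ) : Matrix (Fin 2) (Fin 2) ℝ :=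
  !![p ^ (1 - e.1) * (1 - p) ^ e.1, 0;
     0, (-1) ^ e.1 * (1 / ((e.2 : ℝ) * ((e.2 : ℝ) - 1)))]

/-- The translation vector `v^p_{s,d}`. -/
def transPart (p : ℝ) (e : ℕ × ℕ) : Fin 2 → ℝ :=
  ![(e.1 : ℝ) * p, 1 / ((e.2 : ℝ) - (e.1 : ℝ))]

/-- The affine map `A^p_{s,d}`. -/
def affMap (p : ℝ) (e : ℕ × ℕ) (z : EuclideanSpace ℝ (Fin 2)) : EuclideanSpace ℝ (Fin 2) :=
  WithLp.toLp 2 (Matrix.mulVec (linPart p e) (fun i => z i) + transPart p e)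

/-- The self-affine set of the system `{A^p_{s,d} : (s,d) ∈ J}` on the unit square. -/
def selfAffineSet (p : ℝ) (J : Set (ℕ × ℕ)) : Set (EuclideanSpace ℝ (Fin 2)) :=
  limitSet (fun e : J => affMap p (e : ℕ × ℕ)) unitSquare

end SignedLuroth

end

/-! The maps are diagonal, and they send the open square to pairwise disjoint rectangles inside it.
Write `a_e`, `b_e` for the absolute horizontal and vertical ratios. For `1 < r ≤ 2` the singular
value function of a word is the larger of the two multiplicative weights `a b^(r-1)` and `b
a^(r-1)`, so the series defining the affinity dimension converges exactly when `∑ a_e b_e^(r-1) < 1`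
and `∑ b_e a_e^(r-1) < 1`. It diverges for `r ≤ 1` because `∑ a_e ≥ 1`, and converges for `r > 2`
because `∑ a_e b_e < 1`.

Upper bound: if both sums are at most 1, covering numbers by boxes with independent side lengths
obey a recursion of which `η₀⁻¹ η₁^(1-t) + η₁⁻¹ η₀^(1-t)` is a supersolution
(`exists_finset_cover_boxes`). Setting `η₀ = η₁` gives `O(δ^(-t))` sets.

Lower bound: if one of the sums is at least 1 and the limit set projects onto an interval of the
corresponding axis, the area of the thickening along the other axis obeys a recursion of which
`δ^(2-t)` is a subsolution (`exists_volume_thickening`). Comparing areas yields about `δ^(-t)`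
separated points. The horizontal projection is everything, since both values of `s` occur.
Vertically, either all `d ≥ 3`, so that `∑ b_e < 1` and the second sum never reaches 1, or the two
digits with `d = 2` already fill `[1/2, 1]`.

Separated points bound the box dimension from below directly. For the packing dimension, Baire's
theorem finds a bi-Lipschitz copy of the whole limit set in the closure of one member of any
countable cover. -/

namespace SignedLuroth

/-! ### Covering numbers, separated points and packing premeasure -/

section Metric

variable {X : Type*} [MetricSpace X]

/-- For all small `δ`, the set `F` contains at least `c δ^{-t}` points at mutual distance `> δ`. -/
def SeparatedRate (F : Set X) (t : ℝ) : Prop :=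
  ∃ c > 0, ∃ δ₀ > 0, ∀ δ : ℝ, 0 < δ → δ ≤ δ₀ → ∃ T : Finset X, (T : Set X) ⊆ F ∧
    (T : Set X).Pairwise (fun x y => δ < dist x y) ∧ c * δ ^ (-t) ≤ (T.card : ℝ)

/-- For all small `δ`, the set `F` is covered by at most `C δ^{-t}` sets of diameter `≤ δ`. -/
def CoverRate (F : Set X) (t : ℝ) : Prop :=
  ∃ C > 0, ∃ δ₀ > 0, ∀ δ : ℝ, 0 < δ → δ ≤ δ₀ →
    ((coverNumber δ F : ℕ∞) : ℝ≥0∞) ≤ ENNReal.ofReal (C * δ ^ (-t))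

/-- A set of diameter at most `δ` contains at most one of the points. The family is indexed so that
it also applies to the centres of the balls of a packing. -/
theorem encard_le_coverNumber {ι : Type*} {S : Set ι} {g : ι → X} {F : Set X} {δ : ℝ}
    (hδ : 0 ≤ δ) (hg : ∀ a ∈ S, g a ∈ F) (hsep : S.Pairwise (fun a b => δ < dist (g a) (g b))) :
    S.encard ≤ coverNumber δ F := by
  refine le_iInf fun C => le_iInf fun hF => le_iInf fun hd => ?_
  have hex : ∀ a : ι, ∃ U : Set X, a ∈ S → U ∈ C ∧ g a ∈ U := by
    intro a
    by_cases ha : a ∈ S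
    · obtain ⟨U, hU, hm⟩ := hF (hg a ha)
      exact ⟨U, fun _ => ⟨hU, hm⟩⟩
    · exact ⟨∅, fun h => absurd h ha⟩
  choose U hU using hex
  refine Set.encard_le_encard_of_injOn (f := U) (fun a ha => (hU a ha).1) ?_
  intro a ha b hb hab
  by_contra hne
  have h1 := hsep ha hb hne
  have h2 : edist (g a) (g b) ≤ ENNReal.ofReal δ :=
    (Metric.edist_le_ediam_of_mem (hU a ha).2 (by simpa only [hab] using (hU b hb).2)).trans
      (hd _ (hU a ha).1)
  rw [edist_dist, ENNReal.ofReal_le_ofReal_iff hδ] at h2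
  linarith

theorem eventually_mul_rpow_le_one (C : ℝ) {a : ℝ} (ha : 0 < a) :
    ∀ᶠ δ : ℝ in 𝓝[>] 0, C * δ ^ a ≤ 1 := by
  have h : Tendsto (fun δ : ℝ => C * δ ^ a) (𝓝[>] 0) (𝓝 (C * 0 ^ a)) :=
    ((Real.continuousAt_rpow_const 0 a (Or.inr ha.le)).tendsto.const_mul C).mono_left
      nhdsWithin_le_nhds
  rw [Real.zero_rpow ha.ne', mul_zero] at h
  exact h.eventually_le_const one_pos

theorem eventually_Ioo_nhdsGT_zero {b : ℝ} (hb : 0 < b) :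
    ∀ᶠ δ : ℝ in 𝓝[>] 0, δ ∈ Ioo 0 b := Ioo_mem_nhdsGT hb

theorem log_ofReal_rpow_neg {δ : ℝ} (hδ : 0 < δ) (r : ℝ) :
    ENNReal.log (ENNReal.ofReal (δ ^ (-r))) = ((-Real.log δ : ℝ) : EReal) * (r : EReal) := by
  rw [ENNReal.log_ofReal_of_pos (Real.rpow_pos_of_pos hδ _), Real.log_rpow hδ, ← EReal.coe_mul]
  congr 1
  ring

theorem CoverRate.upperBoxDim_le {F : Set X} {t : ℝ} (h : CoverRate F t) :
    upperBoxDim F ≤ (t : EReal) := by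
  obtain ⟨C, hC, δ₀, hδ₀, h⟩ := h
  refine (EReal.le_of_forall_lt_iff_le).1 fun r hr => ?_
  have hr : t < r := by exact_mod_cast hr
  refine limsup_le_of_le (h := ?_)
  filter_upwards [eventually_mul_rpow_le_one C (sub_pos.2 hr), eventually_Ioo_nhdsGT_zero hδ₀,
    eventually_Ioo_nhdsGT_zero one_pos] with δ h1 h2 h3
  have hlog : 0 < -Real.log δ := by linarith [Real.log_neg h3.1 h3.2]
  refine (EReal.div_le_iff_le_mul (by exact_mod_cast hlog) (EReal.coe_ne_top _)).2 ?_
  rw [← log_ofReal_rpow_neg h3.1]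
  refine ENNReal.log_le_log ((h δ h2.1 h2.2.le).trans (ENNReal.ofReal_le_ofReal ?_))
  have : δ ^ (-t) = δ ^ (r - t) * δ ^ (-r) := by
    rw [← Real.rpow_add h3.1]; congr 1; ring
  rw [this, ← mul_assoc]
  exact mul_le_of_le_one_left (Real.rpow_pos_of_pos h3.1 _).le h1

theorem SeparatedRate.le_lowerBoxDim {F : Set X} {t : ℝ} (h : SeparatedRate F t) :
    (t : EReal) ≤ lowerBoxDim F := by
  obtain ⟨c, hc, δ₀, hδ₀, h⟩ := h
  refine (EReal.ge_of_forall_gt_iff_ge).1 fun r hr => ?_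
  have hr : r < t := by exact_mod_cast hr
  refine le_liminf_of_le (h := ?_)
  filter_upwards [eventually_mul_rpow_le_one c⁻¹ (sub_pos.2 hr), eventually_Ioo_nhdsGT_zero hδ₀,
    eventually_Ioo_nhdsGT_zero one_pos] with δ h1 h2 h3
  have hlog : 0 < -Real.log δ := by linarith [Real.log_neg h3.1 h3.2]
  refine (EReal.le_div_iff_mul_le (by exact_mod_cast hlog) (EReal.coe_ne_top _)).2 ?_
  rw [mul_comm, ← log_ofReal_rpow_neg h3.1]
  obtain ⟨T, hTF, hsep, hcard⟩ := h δ h2.1 h2.2.le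
  have hN := encard_le_coverNumber (g := fun x : X => x) h3.1.le hTF hsep
  refine ENNReal.log_le_log (le_trans (b := ((T.card : ℕ) : ℝ≥0∞)) ?_ ?_)
  · rw [← ENNReal.ofReal_natCast]
    refine ENNReal.ofReal_le_ofReal (le_trans ?_ hcard)
    have : δ ^ (-r) = δ ^ (t - r) * δ ^ (-t) := by
      rw [← Real.rpow_add h3.1]; congr 1; ring
    rw [this]
    refine mul_le_mul_of_nonneg_right ?_ (Real.rpow_pos_of_pos h3.1 _).le
    rwa [inv_mul_le_iff₀ hc, mul_one] at h1
  · rw [Set.encard_coe_eq_coe_finsetCard] at hN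
    exact_mod_cast (ENat.toENNReal_le.2 hN)

theorem lowerBoxDim_le_upperBoxDim (F : Set X) : lowerBoxDim F ≤ upperBoxDim F :=
  liminf_le_limsup

/-- Sort the balls of a packing by dyadic radius. Those of radius about `2^(-n)` have separated
centres, so there are `O(2^(nt))` of them and they contribute `O(2^(-n(s-t)))`. A fine packing
therefore sees only the tail of a convergent geometric series. -/
theorem CoverRate.packingPremeasure_eq_zero {F : Set X} {t s : ℝ} (h : CoverRate F t)
    (hs : 0 ≤ s) (hts : t < s) : packingPremeasure s F = 0 := by
  obtain ⟨C, hC, δ₀, hδ₀, h⟩ := h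
  set f : ℕ → ℝ≥0∞ := fun n =>
    ENNReal.ofReal (C * ((1 / 2 : ℝ) ^ (n + 1)) ^ (-t)) *
      ENNReal.ofReal (2 * (1 / 2 : ℝ) ^ n) ^ s with hf
  have hfn : ∀ n, f n = ENNReal.ofReal (C * (1 / 2 : ℝ) ^ (-t) * 2 ^ s *
      ((1 / 2 : ℝ) ^ (s - t)) ^ n) := by
    intro n
    rw [hf]
    simp only
    rw [ENNReal.ofReal_rpow_of_pos (by positivity), ← ENNReal.ofReal_mul (by positivity)]
    congr 1
    rw [Real.mul_rpow (by norm_num) (by positivity), pow_succ,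
      Real.mul_rpow (by positivity) (by norm_num), ← Real.rpow_natCast, ← Real.rpow_natCast,
      ← Real.rpow_mul (by norm_num), ← Real.rpow_mul (by norm_num), ← Real.rpow_mul (by norm_num)]
    have : (1 / 2 : ℝ) ^ ((s - t) * n) =
        (1 / 2 : ℝ) ^ ((n : ℝ) * -t) * (1 / 2 : ℝ) ^ ((n : ℝ) * s) := by
      rw [← Real.rpow_add (by norm_num)]; congr 1; ring
    rw [this]
    ring
  have hq : (1 / 2 : ℝ) ^ (s - t) < 1 :=
    Real.rpow_lt_one (by norm_num) (by norm_num) (sub_pos.2 hts)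
  have hsum : ∑' n, f n ≠ ⊤ := by
    have hs' : Summable fun n : ℕ => C * (1 / 2 : ℝ) ^ (-t) * 2 ^ s * ((1 / 2 : ℝ) ^ (s - t)) ^ n :=
      (summable_geometric_of_lt_one (by positivity) hq).mul_left _
    simp_rw [hfn]
    exact hs'.tsum_ofReal_ne_top
  have htail := ENNReal.tendsto_sum_nat_add f hsum
  have hle : ∀ᶠ k in atTop, packingPremeasure s F ≤ ∑' n, f (n + k) := by
    have hsmall : ∀ᶠ k : ℕ in atTop, (1 / 2 : ℝ) ^ k ≤ δ₀ :=
      (tendsto_pow_atTop_nhds_zero_of_lt_one (by norm_num) (by norm_num)).eventually_le_const hδ₀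
    filter_upwards [hsmall] with k hk
    refine iInf₂_le_of_le ((1 / 2 : ℝ) ^ k) (by positivity) (iSup₂_le fun P hP => ?_)
    obtain ⟨-, hP1, hP2⟩ := hP
    set A : ℕ → Set P := fun n => {b | (1 / 2 : ℝ) ^ (n + k + 1) < (b : X × ℝ).2 ∧
      (b : X × ℝ).2 ≤ (1 / 2 : ℝ) ^ (n + k)} with hA
    have h1 : ∀ b : P, ENNReal.ofReal (2 * (b : X × ℝ).2) ^ s ≤
        ∑' n, (A n).indicator (fun _ => ENNReal.ofReal (2 * (1 / 2 : ℝ) ^ (n + k)) ^ s) b := by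
      intro b
      obtain ⟨-, hb0, hbk⟩ := hP1 b b.2
      obtain ⟨n, hn1, hn2⟩ := exists_nat_pow_near_of_lt_one hb0
        (hbk.trans (pow_le_one₀ (by norm_num) (by norm_num))) (by norm_num : (0 : ℝ) < 1 / 2)
        (by norm_num)
      have hkn : k < n + 1 := by
        by_contra hcon
        have := pow_le_pow_of_le_one (by norm_num : (0 : ℝ) ≤ 1 / 2) (by norm_num)
          (not_lt.1 hcon)
        linarith
      have hnk : n - k + k = n := by omega
      refine le_trans ?_ (ENNReal.le_tsum (n - k))
      rw [Set.indicator_of_mem (by simp only [hA, mem_ofPred_eq, hnk]; exact ⟨hn1, hn2⟩), hnk]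
      gcongr
    refine (ENNReal.tsum_le_tsum h1).trans ?_
    rw [ENNReal.tsum_comm]
    refine ENNReal.tsum_le_tsum fun n => ?_
    rw [← tsum_subtype, ENNReal.tsum_set_const]
    refine mul_le_mul_left ?_ _
    have hcount : (A n).encard ≤ coverNumber ((1 / 2 : ℝ) ^ (n + k + 1)) F := by
      refine encard_le_coverNumber (g := fun b : P => (b : X × ℝ).1) (by positivity)
        (fun b _ => (hP1 b b.2).1) ?_
      intro a ha b hb hab
      have hd := hP2 a.2 b.2 (fun h => hab (Subtype.ext h))
      -- Otherwise the centre of `b` lies in the ball of `a`, whose radius exceeds `2^(-(n+k+1))`.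
      by_contra hcon
      have hmem : (b : X × ℝ).1 ∈ Metric.closedBall (a : X × ℝ).1 (a : X × ℝ).2 := by
        rw [Metric.mem_closedBall, dist_comm]
        exact (not_lt.1 hcon).trans ha.1.le
      exact Set.disjoint_left.1 hd hmem (Metric.mem_closedBall_self (hP1 b b.2).2.1.le)
    refine (ENat.toENNReal_le.2 hcount).trans (h _ (by positivity) (le_trans ?_ hk))
    exact pow_le_pow_of_le_one (by norm_num) (by norm_num) (by omega)
  exact le_antisymm (ge_of_tendsto htail hle) (zero_le)

theorem packingMeasure_eq_zero_of_premeasure {F : Set X} {s : ℝ} (h : packingPremeasure s F = 0) :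
    packingMeasure s F = 0 := by
  refine le_antisymm (iInf₂_le_of_le (fun _ => F) (subset_iUnion (fun _ : ℕ => F) 0) ?_)
    (zero_le)
  simp [h]

theorem CoverRate.packingDim_le {F : Set X} {t : ℝ} (h : CoverRate F t) (ht : 0 ≤ t) :
    packingDim F ≤ (t : EReal) := by
  refine (EReal.le_of_forall_lt_iff_le).1 fun r hr => ?_
  have hr : t < r := by exact_mod_cast hr
  have h0 : 0 ≤ r := ht.trans hr.le
  exact iInf_le_of_le r (iInf₂_le_of_le h0
    (packingMeasure_eq_zero_of_premeasure (h.packingPremeasure_eq_zero h0 hr)) le_rfl)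

/-- Separated points of `A` can be moved slightly into `E`, where they carry packings by balls of
equal radius `δ` whose sum is of order `δ^(s-t)`, hence at least 1 for small `δ`. Allowing the
closure of `E` is what makes Baire's theorem usable. -/
theorem SeparatedRate.one_le_packingPremeasure {A E : Set X} {t s : ℝ} (h : SeparatedRate A t)
    (hst : s < t) (hAE : A ⊆ closure E) : 1 ≤ packingPremeasure s E := by
  obtain ⟨c, hc, δ₀, hδ₀, h⟩ := h
  refine le_iInf₂ fun η hη => ?_
  have hev := (eventually_mul_rpow_le_one (c * (4 : ℝ) ^ (-t) * 2 ^ s)⁻¹ (sub_pos.2 hst)).and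
    ((eventually_Ioo_nhdsGT_zero hη).and (eventually_Ioo_nhdsGT_zero (b := δ₀ / 4) (by linarith)))
  obtain ⟨δ, h1, ⟨hδ, hδη⟩, -, hδδ₀⟩ := hev.exists
  -- Moving both endpoints by less than `δ` leaves a distance above `2δ`, so closed `δ`-balls stay
  -- disjoint.
  obtain ⟨T, hTA, hsep, hcard⟩ := h (4 * δ) (by linarith) (by linarith)
  have hex : ∀ x : X, ∃ y : X, x ∈ T → y ∈ E ∧ dist x y < δ := by
    intro x
    by_cases hx : x ∈ T
    · obtain ⟨y, hy, hd⟩ := Metric.mem_closure_iff.1 (hAE (hTA hx)) δ hδ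
      exact ⟨y, fun _ => ⟨hy, hd⟩⟩
    · exact ⟨x, fun h => absurd h hx⟩
  choose y hy using hex
  have hfar : ∀ a ∈ T, ∀ b ∈ T, a ≠ b → 2 * δ < dist (y a) (y b) := by
    intro a ha b hb hab
    have h1 := hsep ha hb hab
    have h2 := (hy a ha).2
    have h3 := (hy b hb).2
    have h4 := dist_triangle4 a (y a) (y b) b
    rw [dist_comm (y b) b] at h4
    simp only at h1
    linarith
  have hinj : InjOn (fun x => (y x, δ)) (T : Set X) := by
    intro a ha b hb hab
    by_contra hne
    have h1 := hfar a ha b hb hne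
    have h2 : y a = y b := (Prod.ext_iff.1 hab).1
    rw [h2, dist_self] at h1
    linarith
  have hpack : IsPacking η E ((fun x => (y x, δ)) '' (T : Set X)) := by
    refine ⟨(T.finite_toSet.image _).countable, ?_, ?_⟩
    · rintro _ ⟨x, hx, rfl⟩
      exact ⟨(hy x hx).1, hδ, hδη.le⟩
    · rintro _ ⟨a, ha, rfl⟩ _ ⟨b, hb, rfl⟩ hab
      refine Metric.closedBall_disjoint_closedBall ?_
      have := hfar a ha b hb (by rintro rfl; exact hab rfl)
      simp only
      linarith
  refine le_trans ?_ (le_iSup₂_of_le _ hpack le_rfl)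
  have hval : ∀ b : ((fun x => (y x, δ)) '' (T : Set X)),
      ENNReal.ofReal (2 * (b : X × ℝ).2) ^ s = ENNReal.ofReal (2 * δ) ^ s := by
    rintro ⟨_, x, hx, rfl⟩
    rfl
  rw [tsum_congr hval, ENNReal.tsum_set_const, hinj.encard_image,
    Set.encard_coe_eq_coe_finsetCard, ENNReal.ofReal_rpow_of_pos (by linarith)]
  have : ((T.card : ℕ∞) : ℝ≥0∞) = ENNReal.ofReal (T.card : ℝ) := by simp
  rw [this, ← ENNReal.ofReal_mul (by positivity), ENNReal.one_le_ofReal]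
  rw [inv_mul_le_iff₀ (by positivity), mul_one] at h1
  calc (1 : ℝ) = δ ^ (t - s) * δ ^ (-t) * δ ^ s := by
        rw [← Real.rpow_add hδ, ← Real.rpow_add hδ, show t - s + -t + s = 0 by ring,
          Real.rpow_zero]
    _ ≤ (c * (4 : ℝ) ^ (-t) * 2 ^ s) * δ ^ (-t) * δ ^ s := by gcongr
    _ = c * (4 * δ) ^ (-t) * (2 * δ) ^ s := by
        rw [Real.mul_rpow (by norm_num) hδ.le, Real.mul_rpow (by norm_num) hδ.le]; ring
    _ ≤ (T.card : ℝ) * (2 * δ) ^ s := by gcongr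

theorem SeparatedRate.image {Y : Type*} [MetricSpace Y] {F : Set X} {t : ℝ}
    (h : SeparatedRate F t) {g : X → Y} {c : ℝ} (hc : 0 < c)
    (hg : ∀ x y, c * dist x y ≤ dist (g x) (g y)) : SeparatedRate (g '' F) t := by
  classical
  obtain ⟨c₁, hc₁, δ₀, hδ₀, h⟩ := h
  refine ⟨c₁ * c ^ t, by positivity, c * δ₀, by positivity, fun δ hδ hδ' => ?_⟩
  obtain ⟨T, hTF, hsep, hcard⟩ := h (δ / c) (by positivity) (by rwa [div_le_iff₀' hc])
  have hinj : Function.Injective g := by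
    intro x y hxy
    have := hg x y
    rw [hxy, dist_self] at this
    exact dist_le_zero.1 (nonpos_of_mul_nonpos_right this hc)
  refine ⟨T.image g, ?_, ?_, ?_⟩
  · rw [Finset.coe_image]; exact image_mono hTF
  · rw [Finset.coe_image]
    rintro _ ⟨x, hx, rfl⟩ _ ⟨y, hy, rfl⟩ hxy
    have h1 := hsep hx hy (by rintro rfl; exact hxy rfl)
    simp only [div_lt_iff₀' hc] at h1
    exact h1.trans_le (hg x y)
  · rw [Finset.card_image_of_injective _ hinj]
    refine le_trans (le_of_eq ?_) hcard
    rw [Real.div_rpow hδ.le hc.le, Real.rpow_neg hc.le, div_inv_eq_mul]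
    ring

end Metric

/-! ### Codings and invariance of limit sets -/

section LimitSet

variable {X I : Type*} {f : I → X → X} {K : Set X}

theorem prefixMap_congr {ω ω' : ℕ → I} {n : ℕ} (h : ∀ i < n, ω i = ω' i) :
    prefixMap f ω n = prefixMap f ω' n := by
  induction n with
  | zero => rfl
  | succ n ih =>
    simp only [prefixMap, ih fun i hi => h i (by omega), h n (by omega)]

theorem prefixMap_add (ω : ℕ → I) (n k : ℕ) :
    prefixMap f ω (n + k) = prefixMap f ω n ∘ prefixMap f (fun j => ω (n + j)) k := by
  induction k with
  | zero => rfl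
  | succ k ih => rw [← add_assoc, prefixMap, ih, prefixMap, Function.comp_assoc]

theorem prefixMap_succ_left (ω : ℕ → I) (k : ℕ) :
    prefixMap f ω (k + 1) = f (ω 0) ∘ prefixMap f (fun j => ω (j + 1)) k := by
  rw [add_comm, prefixMap_add]
  simp only [add_comm 1]
  rfl

theorem limitSet_subset : limitSet f K ⊆ K := by
  refine iUnion_subset fun ω z hz => ?_
  simpa [prefixMap] using mem_iInter.1 hz 0

theorem mapsTo_limitSet (hK : ∀ e, MapsTo (f e) K K) (e : I) :
    MapsTo (f e) (limitSet f K) (limitSet f K) := by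
  intro z hz
  obtain ⟨ω, hω⟩ := mem_iUnion.1 hz
  refine mem_iUnion.2 ⟨fun n => Nat.casesOn n e ω, mem_iInter.2 fun k => ?_⟩
  cases k with
  | zero =>
    refine ⟨f e z, hK e (limitSet_subset hz), rfl⟩
  | succ k =>
    rw [prefixMap_succ_left, image_comp]
    exact mem_image_of_mem _ (mem_iInter.1 hω k)

/-- Injectivity makes the preimages of `z` under the first map, one for each level `k`, a single
point. -/
theorem limitSet_subset_iUnion (hinj : ∀ e, Function.Injective (f e)) :
    ∀ z ∈ limitSet f K, ∃ e, ∃ w ∈ limitSet f K, f e w = z := by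
  intro z hz
  obtain ⟨ω, hω⟩ := mem_iUnion.1 hz
  have h : ∀ k, z ∈ f (ω 0) '' (prefixMap f (fun j => ω (j + 1)) k '' K) := by
    intro k
    rw [← image_comp, ← prefixMap_succ_left]
    exact mem_iInter.1 hω (k + 1)
  obtain ⟨w, -, hw⟩ := h 0
  refine ⟨ω 0, w, mem_iUnion.2 ⟨fun j => ω (j + 1), mem_iInter.2 fun k => ?_⟩, hw⟩
  obtain ⟨w', hw', hw''⟩ := h k
  rwa [← hinj _ (hw''.trans hw.symm)]

theorem continuous_prefixMap [TopologicalSpace X] (hf : ∀ e, Continuous (f e)) (ω : ℕ → I) (k : ℕ) :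
    Continuous (prefixMap f ω k) := by
  induction k with
  | zero => exact continuous_id
  | succ k ih => exact ih.comp (hf _)

/-- Cantor's intersection theorem. With `S k = K` it supplies a point for each coding; with slices
of the square it supplies a point with a prescribed coordinate. -/
theorem exists_mem_iInter_prefixMap [TopologicalSpace X] [T2Space X] (hf : ∀ e, Continuous (f e))
    (ω : ℕ → I) (S : ℕ → Set X) (hS : ∀ k, IsCompact (S k)) (hne : ∀ k, (S k).Nonempty)
    (hSK : ∀ k, S k ⊆ K) (hmap : ∀ k, MapsTo (f (ω k)) (S (k + 1)) (S k)) :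
    ∃ z ∈ S 0, z ∈ ⋂ k, prefixMap f ω k '' K := by
  have hc : ∀ k, IsCompact (prefixMap f ω k '' S k) := fun k =>
    (hS k).image (continuous_prefixMap hf ω k)
  obtain ⟨z, hz⟩ := IsCompact.nonempty_iInter_of_sequence_nonempty_isCompact_isClosed
    (fun k => prefixMap f ω k '' S k)
    (fun k => by
      rw [prefixMap, image_comp]
      exact image_mono (hmap k).image_subset)
    (fun k => (hne k).image _) (hc 0) (fun k => (hc k).isClosed)
  rw [mem_iInter] at hz
  exact ⟨z, by simpa [prefixMap] using hz 0, mem_iInter.2 fun k => image_mono (hSK k) (hz k)⟩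

end LimitSet

/-! ### Lower bound for the packing dimension by Baire category -/

section Packing

variable {X I : Type*} [MetricSpace X] {f : I → X → X} {K : Set X} {θ c : ℝ}

theorem dist_prefixMap_le (hθ : 0 ≤ θ) (hf : ∀ e x y, dist (f e x) (f e y) ≤ θ * dist x y)
    (ω : ℕ → I) (k : ℕ) (x y : X) :
    dist (prefixMap f ω k x) (prefixMap f ω k y) ≤ θ ^ k * dist x y := by
  induction k generalizing x y with
  | zero => simp [prefixMap]
  | succ k ih =>
    refine (ih _ _).trans ?_
    rw [pow_succ, mul_assoc]
    exact mul_le_mul_of_nonneg_left (hf _ _ _) (by positivity)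

theorem le_dist_prefixMap (hc : 0 ≤ c) (hf : ∀ e x y, c * dist x y ≤ dist (f e x) (f e y))
    (ω : ℕ → I) (k : ℕ) (x y : X) :
    c ^ k * dist x y ≤ dist (prefixMap f ω k x) (prefixMap f ω k y) := by
  induction k generalizing x y with
  | zero => simp [prefixMap]
  | succ k ih =>
    refine le_trans ?_ (ih _ _)
    rw [pow_succ, mul_assoc]
    exact mul_le_mul_of_nonneg_left (hf _ _ _) (by positivity)

theorem dist_le_of_mem_prefixMap_image {D : ℝ} (hθ : 0 ≤ θ)
    (hf : ∀ e x y, dist (f e x) (f e y) ≤ θ * dist x y) (hD : ∀ x ∈ K, ∀ y ∈ K, dist x y ≤ D)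
    {ω : ℕ → I} {k : ℕ} {x y : X} (hx : x ∈ prefixMap f ω k '' K)
    (hy : y ∈ prefixMap f ω k '' K) : dist x y ≤ θ ^ k * D := by
  obtain ⟨x, hx, rfl⟩ := hx
  obtain ⟨y, hy, rfl⟩ := hy
  exact (dist_prefixMap_le hθ hf ω k x y).trans
    (mul_le_mul_of_nonneg_left (hD x hx y hy) (by positivity))

/-- In a cover of the limit set by countably many sets, the closure of one of them contains the
image of the whole limit set under some finite composition. -/
theorem exists_prefixMap_image_subset_closure [Finite I] [Nonempty I] (hKc : IsCompact K)
    (hKne : K.Nonempty) (hK : ∀ e, MapsTo (f e) K K) (hθ : 0 ≤ θ) (hθ1 : θ < 1)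
    (hf : ∀ e x y, dist (f e x) (f e y) ≤ θ * dist x y) (E : ℕ → Set X)
    (hE : limitSet f K ⊆ ⋃ i, E i) :
    ∃ (i n : ℕ) (ω : ℕ → I), prefixMap f ω n '' limitSet f K ⊆ closure (E i) := by
  -- With the discrete topology on `I` the sequence space is a Baire space, and the coding map `π`
  -- chosen below is continuous because level-`k` pieces have diameter at most `θ ^ k * D`.
  let : TopologicalSpace I := ⊥
  have : DiscreteTopology I := ⟨rfl⟩
  have hcont : ∀ e, Continuous (f e) := fun e =>
    (LipschitzWith.of_dist_le_mul (K := ⟨θ, hθ⟩) fun x y => hf e x y).continuous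
  obtain ⟨D, hD⟩ := Metric.isBounded_iff.1 hKc.isBounded
  have hD : ∀ x ∈ K, ∀ y ∈ K, dist x y ≤ D := fun x hx y hy => hD hx hy
  have hpow : Tendsto (fun k : ℕ => θ ^ k * D) atTop (𝓝 0) := by
    simpa using (tendsto_pow_atTop_nhds_zero_of_lt_one hθ hθ1).mul_const D
  have hex : ∀ ω : ℕ → I, ∃ z, z ∈ ⋂ k, prefixMap f ω k '' K := fun ω => by
    obtain ⟨z, -, hz⟩ := exists_mem_iInter_prefixMap hcont ω (fun _ => K) (fun _ => hKc)
      (fun _ => hKne) (fun _ => subset_rfl) (fun k => hK (ω k))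
    exact ⟨z, hz⟩
  choose π hπ using hex
  have hπc : Continuous π := by
    rw [continuous_iff_continuousAt]
    intro ω
    rw [ContinuousAt, Metric.tendsto_nhds]
    intro ε hε
    obtain ⟨k, hk⟩ := (hpow.eventually_lt_const hε).exists
    filter_upwards [(PiNat.isOpen_cylinder (fun _ => I) ω k).mem_nhds
      (PiNat.self_mem_cylinder ω k)] with ω' hω'
    refine lt_of_le_of_lt ?_ hk
    refine dist_le_of_mem_prefixMap_image hθ hf hD (ω := ω) ?_ (mem_iInter.1 (hπ ω) k)
    rw [← prefixMap_congr hω']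
    exact mem_iInter.1 (hπ ω') k
  obtain ⟨i, x₀, hx₀⟩ := nonempty_interior_of_iUnion_of_closed
    (f := fun i => π ⁻¹' closure (E i)) (fun i => isClosed_closure.preimage hπc) (by
      refine eq_univ_of_forall fun ω => ?_
      obtain ⟨i, hi⟩ := mem_iUnion.1 (hE (mem_iUnion.2 ⟨ω, hπ ω⟩))
      exact mem_iUnion.2 ⟨i, subset_closure hi⟩)
  obtain ⟨_, ⟨ω, n, rfl⟩, -, hsub⟩ :=
    (PiNat.isTopologicalBasis_cylinders (fun _ => I)).mem_nhds_iff.1 (mem_interior_iff_mem_nhds.1 hx₀)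
  refine ⟨i, n, ω, ?_⟩
  rintro _ ⟨z, hz, rfl⟩
  obtain ⟨ω', hω'⟩ := mem_iUnion.1 hz
  -- The first `n` letters of `ω` followed by `ω'`. The image of `z` and `π τ` share every piece
  -- along `τ` from level `n` on, hence coincide.
  set τ : ℕ → I := fun j => if j < n then ω j else ω' (j - n) with hτ
  have hτω : prefixMap f τ n = prefixMap f ω n := prefixMap_congr fun j hj => by simp [hτ, hj]
  have hmem : ∀ k, prefixMap f ω n z ∈ prefixMap f τ (n + k) '' K := by
    intro k
    rw [prefixMap_add, hτω, image_comp]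
    refine mem_image_of_mem _ ?_
    have : (fun j => τ (n + j)) = ω' := by
      funext j; simp [hτ]
    rw [this]
    exact mem_iInter.1 hω' k
  have heq : prefixMap f ω n z = π τ := by
    refine dist_le_zero.1 (ge_of_tendsto (hpow.comp (tendsto_add_atTop_nat n)) ?_)
    refine Eventually.of_forall fun k => ?_
    have := dist_le_of_mem_prefixMap_image hθ hf hD (hmem k) (mem_iInter.1 (hπ τ) (n + k))
    simpa [Function.comp_def, add_comm] using this
  rw [heq]
  exact hsub fun j hj => by simp [hτ, hj]

/-- For `s < t`, every countable cover has a member of premeasure at least 1, so the `s`-dimensional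
packing measure cannot vanish. -/
theorem SeparatedRate.le_packingDim_limitSet [Finite I] [Nonempty I] (hKc : IsCompact K)
    (hKne : K.Nonempty) (hK : ∀ e, MapsTo (f e) K K) (hθ : 0 ≤ θ) (hθ1 : θ < 1)
    (hf : ∀ e x y, dist (f e x) (f e y) ≤ θ * dist x y) (hc : 0 < c)
    (hf' : ∀ e x y, c * dist x y ≤ dist (f e x) (f e y)) {t : ℝ}
    (h : SeparatedRate (limitSet f K) t) : (t : EReal) ≤ packingDim (limitSet f K) := by
  refine le_iInf fun s => le_iInf₂ fun hs h0 => ?_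
  by_contra hcon
  have hst : s < t := by exact_mod_cast not_le.1 hcon
  have : 1 ≤ packingMeasure s (limitSet f K) := by
    refine le_iInf₂ fun E hE => ?_
    obtain ⟨i, n, ω, hi⟩ := exists_prefixMap_image_subset_closure hKc hKne hK hθ hθ1 hf E hE
    exact ((h.image (pow_pos hc n) (le_dist_prefixMap hc.le hf' ω n)).one_le_packingPremeasure
      hst hi).trans (ENNReal.le_tsum i)
  rw [h0] at this
  simp at this

end Packing

/-! ### Diagonal maps and the lower bound by area -/

section DiagonalMap

open MeasureTheory

/-- The affine map of the plane with diagonal linear part `ℓ` and translation vector `v`. -/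
def diagMap (ℓ v : Fin 2 → ℝ) (z : EuclideanSpace ℝ (Fin 2)) : EuclideanSpace ℝ (Fin 2) :=
  WithLp.toLp 2 fun i => ℓ i * z i + v i

@[simp]
theorem diagMap_apply (ℓ v : Fin 2 → ℝ) (z : EuclideanSpace ℝ (Fin 2)) (i : Fin 2) :
    diagMap ℓ v z i = ℓ i * z i + v i := rfl

theorem continuous_diagMap (ℓ v : Fin 2 → ℝ) : Continuous (diagMap ℓ v) := by
  unfold diagMap
  fun_prop

theorem injective_diagMap {ℓ : Fin 2 → ℝ} (v : Fin 2 → ℝ) (hℓ : ∀ i, ℓ i ≠ 0) :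
    Function.Injective (diagMap ℓ v) := by
  intro z w h
  ext i
  have := congrArg (fun u : EuclideanSpace ℝ (Fin 2) => u i) h
  simpa [hℓ i] using this

theorem det_toEuclideanLin_diagonal (d : Fin 2 → ℝ) :
    LinearMap.det (Matrix.toEuclideanLin (Matrix.diagonal d)) = d 0 * d 1 := by
  have h : (Matrix.toEuclideanLin : Matrix (Fin 2) (Fin 2) ℝ ≃ₗ[ℝ] _) = Matrix.toLin
      (PiLp.basisFun 2 ℝ (Fin 2)) (PiLp.basisFun 2 ℝ (Fin 2)) := Matrix.toLpLin_eq_toLin 2 2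
  rw [h, LinearMap.det_toLin, Matrix.det_diagonal, Fin.prod_univ_two]

theorem volume_image_diagMap (ℓ v : Fin 2 → ℝ) (s : Set (EuclideanSpace ℝ (Fin 2))) :
    volume (diagMap ℓ v '' s) = ENNReal.ofReal |ℓ 0 * ℓ 1| * volume s := by
  have him : diagMap ℓ v '' s = (fun z => z + WithLp.toLp 2 v) ''
      (Matrix.toEuclideanLin (Matrix.diagonal ℓ) '' s) := by
    rw [image_image]
    refine image_congr fun z _ => ?_
    ext i
    fin_cases i <;> simp [diagMap, Matrix.toLpLin_apply]
  rw [him, image_add_right, measure_preimage_add_right, Measure.addHaar_image_linearMap,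
    det_toEuclideanLin_diagonal]

theorem dist_le_of_forall_abs_le {z w : EuclideanSpace ℝ (Fin 2)} {a b : ℝ}
    (h0 : |z 0 - w 0| ≤ a) (h1 : |z 1 - w 1| ≤ b) : dist z w ≤ a + b := by
  have ha := (abs_nonneg _).trans h0
  have hb := (abs_nonneg _).trans h1
  rw [EuclideanSpace.dist_eq, Fin.sum_univ_two, Real.dist_eq, Real.dist_eq,
    Real.sqrt_le_left (by positivity)]
  nlinarith [mul_self_le_mul_self (abs_nonneg _) h0, mul_self_le_mul_self (abs_nonneg _) h1]

theorem dist_le_of_apply_eq {z w : EuclideanSpace ℝ (Fin 2)} {i k : Fin 2} (hik : i ≠ k) {a : ℝ}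
    (hi : w i = z i) (hk : |w k - z k| ≤ a) : dist z w ≤ a := by
  rw [dist_comm]
  have hk' : k = 0 ∧ i = 1 ∨ k = 1 ∧ i = 0 := by omega
  rcases hk' with ⟨rfl, rfl⟩ | ⟨rfl, rfl⟩
  · simpa using dist_le_of_forall_abs_le hk (b := 0) (by simp [hi])
  · simpa using dist_le_of_forall_abs_le (a := 0) (by simp [hi]) hk

theorem dist_diagMap_le {ℓ v : Fin 2 → ℝ} {θ : ℝ} (hℓ : ∀ i, |ℓ i| ≤ θ)
    (z w : EuclideanSpace ℝ (Fin 2)) :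
    dist (diagMap ℓ v z) (diagMap ℓ v w) ≤ θ * dist z w := by
  have hθ : 0 ≤ θ := (abs_nonneg _).trans (hℓ 0)
  rw [EuclideanSpace.dist_eq, EuclideanSpace.dist_eq, Fin.sum_univ_two, Fin.sum_univ_two,
    Real.sqrt_le_left (by positivity), mul_pow, Real.sq_sqrt (by positivity)]
  simp only [diagMap_apply, Real.dist_eq, sq_abs, add_sub_add_right_eq_sub, ← mul_sub, mul_pow]
  have h0 := sq_le_sq' (by linarith [abs_nonneg (ℓ 0), hℓ 0]) (hℓ 0)
  have h1 := sq_le_sq' (by linarith [abs_nonneg (ℓ 1), hℓ 1]) (hℓ 1)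
  rw [sq_abs] at h0 h1
  rw [mul_add]
  gcongr

theorem le_dist_diagMap {ℓ v : Fin 2 → ℝ} {c : ℝ} (hc : 0 ≤ c) (hℓ : ∀ i, c ≤ |ℓ i|)
    (z w : EuclideanSpace ℝ (Fin 2)) :
    c * dist z w ≤ dist (diagMap ℓ v z) (diagMap ℓ v w) := by
  rw [EuclideanSpace.dist_eq, EuclideanSpace.dist_eq, Fin.sum_univ_two, Fin.sum_univ_two]
  refine Real.le_sqrt_of_sq_le ?_
  rw [mul_pow, Real.sq_sqrt (by positivity)]
  simp only [diagMap_apply, Real.dist_eq, sq_abs, add_sub_add_right_eq_sub, ← mul_sub, mul_pow]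
  have h0 := pow_le_pow_left₀ hc (hℓ 0) 2
  have h1 := pow_le_pow_left₀ hc (hℓ 1) 2
  rw [sq_abs] at h0 h1
  rw [mul_add]
  gcongr

/-- Greedy selection: a separated set that is not yet a `δ`-net can be enlarged. Stopping at size
`M` avoids any compactness assumption on `F`. -/
theorem exists_separated_or_cover {X : Type*} [MetricSpace X] (F : Set X) {δ : ℝ}
    (hδ : 0 ≤ δ) (M : ℕ) :
    ∃ T : Finset X, (T : Set X) ⊆ F ∧ (T : Set X).Pairwise (fun x y => δ < dist x y) ∧
      (M ≤ T.card ∨ ∀ z ∈ F, ∃ x ∈ T, dist z x ≤ δ) := by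
  classical
  induction M with
  | zero => exact ⟨∅, by simp⟩
  | succ M ih =>
    obtain ⟨T, hTF, hsep, hT⟩ := ih
    by_cases hcov : ∀ z ∈ F, ∃ x ∈ T, dist z x ≤ δ
    · exact ⟨T, hTF, hsep, Or.inr hcov⟩
    · have hM : M ≤ T.card := hT.resolve_right hcov
      push Not at hcov
      obtain ⟨z, hz, hzT⟩ := hcov
      have hzm : z ∉ T := fun hzm => by
        have := hzT z hzm
        rw [dist_self] at this
        linarith
      refine ⟨insert z T, ?_, ?_, Or.inl ?_⟩
      · rw [Finset.coe_insert]; exact insert_subset hz hTF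
      · rw [Finset.coe_insert]
        refine hsep.insert fun x hx _ => ⟨hzT x hx, ?_⟩
        rw [dist_comm]; exact hzT x hx
      · rw [Finset.card_insert_of_notMem hzm]; omega

/-- The open unit square. -/
def openSquare : Set (EuclideanSpace ℝ (Fin 2)) := {z | ∀ i, z i ∈ Ioo (0 : ℝ) 1}

theorem isOpen_setOf_apply_mem {a b : Fin 2 → ℝ} :
    IsOpen {z : EuclideanSpace ℝ (Fin 2) | ∀ i, z i ∈ Ioo (a i) (b i)} := by
  simp only [Set.ofPred_forall]
  exact isOpen_iInter_of_finite fun i => isOpen_Ioo.preimage (by fun_prop)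

variable {I : Type*} [Fintype I] {ℓ v : I → Fin 2 → ℝ} {F : Set (EuclideanSpace ℝ (Fin 2))}

/-- The part of the unit square within distance `δ` of `F` in the direction of the `k`-th axis has
area of order at least `δ^{2-t}`. -/
theorem exists_volume_thickening (hℓ : ∀ e j, ℓ e j ≠ 0)
    (hU : ∀ e, MapsTo (diagMap (ℓ e) (v e)) openSquare openSquare)
    (hdisj : Pairwise fun e e' => Disjoint (diagMap (ℓ e) (v e) '' openSquare)
      (diagMap (ℓ e') (v e') '' openSquare))
    (hF : ∀ e, MapsTo (diagMap (ℓ e) (v e)) F F) (hFK : F ⊆ unitSquare)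
    {i k : Fin 2} (hik : i ≠ k) {θ : ℝ} (hθ1 : θ < 1) (hθ : ∀ e, |ℓ e k| ≤ θ)
    {a b : ℝ} (ha : 0 ≤ a) (hab : a < b) (hb : b ≤ 1) (hproj : ∀ x ∈ Ioo a b, ∃ w ∈ F, w i = x)
    {t : ℝ} (ht : t ≤ 2) (hsum : 1 ≤ ∑ e, |ℓ e i| * |ℓ e k| ^ (t - 1)) :
    ∃ c > 0, ∀ δ, 0 < δ → δ ≤ 1 → ∃ R : Set (EuclideanSpace ℝ (Fin 2)),
      (∀ z ∈ R, ∃ w ∈ F, w i = z i ∧ |w k - z k| ≤ δ) ∧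
      ENNReal.ofReal (c * δ ^ (2 - t)) ≤ volume R := by
  have hlpos : ∀ e j, 0 < |ℓ e j| := fun e j => abs_pos.2 (hℓ e j)
  -- For `δ < 1` the rescaled width `δ / |ℓ e k|` is at most `B`, so the base case need only treat
  -- widths in `[1, B]`; there the whole strip `R₀` works, and `c` is chosen to make its area
  -- suffice.
  obtain ⟨B, hB1, hB⟩ : ∃ B : ℝ, 1 ≤ B ∧ ∀ e, |ℓ e k|⁻¹ ≤ B := by
    obtain ⟨B, hB⟩ := (finite_range fun e => |ℓ e k|⁻¹).bddAbove
    exact ⟨max 1 B, le_max_left _ _, fun e => (hB (mem_range_self e)).trans (le_max_right _ _)⟩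
  set R₀ : Set (EuclideanSpace ℝ (Fin 2)) :=
    {z | ∀ j, z j ∈ Ioo (if j = i then a else 0) (if j = i then b else 1)} with hR₀
  have hR₀o : IsOpen R₀ := isOpen_setOf_apply_mem
  have hR₀U : R₀ ⊆ openSquare := by
    intro z hz j
    have := hz j
    by_cases hj : j = i
    · simp only [hj, if_true] at this ⊢
      exact ⟨by linarith [this.1], by linarith [this.2]⟩
    · simpa [hj] using this
  have hR₀ne : R₀.Nonempty := by
    refine ⟨WithLp.toLp 2 fun j => if j = i then (a + b) / 2 else 1 / 2, fun j => ?_⟩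
    by_cases hj : j = i
    · simp only [hj, if_true]
      constructor <;> linarith
    · simp only [hj, if_false]
      norm_num
  obtain ⟨c', -, hc'0, hc'⟩ := ENNReal.lt_iff_exists_real_btwn.1 (hR₀o.measure_pos volume hR₀ne)
  have hc'0 : 0 < c' := by simpa using hc'0
  have hBpos : 0 < B ^ (2 - t) := by positivity
  set c := c' / B ^ (2 - t) with hc
  have hcpos : 0 < c := by positivity
  -- Rescaling divides `δ` by a number at most `θ`, which lowers `n` by one. Keeping `R` inside the
  -- open square makes the images disjoint, so that areas add.
  have main : ∀ n : ℕ, ∀ δ, 0 < δ → δ ≤ B → θ ^ n ≤ δ → ∃ R ⊆ openSquare, MeasurableSet R ∧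
      (∀ z ∈ R, ∃ w ∈ F, w i = z i ∧ |w k - z k| ≤ δ) ∧
      ENNReal.ofReal (c * δ ^ (2 - t)) ≤ volume R := by
    have base : ∀ δ, 1 ≤ δ → δ ≤ B → ∃ R ⊆ openSquare, MeasurableSet R ∧
        (∀ z ∈ R, ∃ w ∈ F, w i = z i ∧ |w k - z k| ≤ δ) ∧
        ENNReal.ofReal (c * δ ^ (2 - t)) ≤ volume R := by
      intro δ hδ1 hδB
      refine ⟨R₀, hR₀U, hR₀o.measurableSet, fun z hz => ?_, ?_⟩
      · obtain ⟨w, hw, hwz⟩ := hproj (z i) (by simpa using hz i)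
        refine ⟨w, hw, hwz, ?_⟩
        have h1 := hFK hw k
        have h2 := hR₀U hz k
        rw [abs_le]
        constructor <;> linarith [h1.1, h1.2, h2.1, h2.2]
      · refine (ENNReal.ofReal_le_ofReal ?_).trans hc'.le
        rw [hc, div_mul_eq_mul_div, div_le_iff₀ hBpos]
        gcongr
    intro n
    induction n with
    | zero => exact fun δ _ hB h1 => base δ (by simpa using h1) hB
    | succ n ih =>
      intro δ hδ hδB hn
      by_cases hδ1 : 1 ≤ δ
      · exact base δ hδ1 hδB
      have hstep : ∀ e, ∃ R ⊆ openSquare, MeasurableSet R ∧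
          (∀ z ∈ R, ∃ w ∈ F, w i = z i ∧ |w k - z k| ≤ δ / |ℓ e k|) ∧
          ENNReal.ofReal (c * (δ / |ℓ e k|) ^ (2 - t)) ≤ volume R := by
        intro e
        refine ih _ (div_pos hδ (hlpos e k)) ?_ ?_
        · rw [div_eq_mul_inv]
          exact (mul_le_of_le_one_left (inv_nonneg.2 (abs_nonneg _)) (not_le.1 hδ1).le).trans (hB e)
        · rw [le_div_iff₀ (hlpos e k)]
          refine le_trans ?_ hn
          rw [pow_succ]
          have := (abs_nonneg _).trans (hθ e)
          exact mul_le_mul_of_nonneg_left (hθ e) (by positivity)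
      choose R hRU hRm hRF hRv using hstep
      refine ⟨⋃ e, diagMap (ℓ e) (v e) '' R e, ?_, ?_, ?_, ?_⟩
      · exact iUnion_subset fun e => (image_mono (hRU e)).trans (hU e).image_subset
      · exact MeasurableSet.iUnion fun e => (hRm e).image_of_continuousOn_injOn
          (continuous_diagMap _ _).continuousOn (injective_diagMap _ (hℓ e)).injOn
      · intro z hz
        obtain ⟨e, z', hz', rfl⟩ := mem_iUnion.1 hz
        obtain ⟨w, hw, hwi, hwk⟩ := hRF e z' hz'
        refine ⟨_, hF e hw, by simp [hwi], ?_⟩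
        rw [le_div_iff₀ (hlpos e k)] at hwk
        simp only [diagMap_apply, add_sub_add_right_eq_sub, ← mul_sub, abs_mul]
        rwa [mul_comm]
      · rw [measure_iUnion]
        · rw [tsum_fintype]
          -- The area factor `|ℓ e i| |ℓ e k|` times `(δ / |ℓ e k|)^(2-t)` is the summand `|ℓ e i|
          -- |ℓ e k|^(t-1)` times `δ^(2-t)`.
          have hle : ∀ e, ENNReal.ofReal (c * δ ^ (2 - t) * (|ℓ e i| * |ℓ e k| ^ (t - 1))) ≤
              volume (diagMap (ℓ e) (v e) '' R e) := by
            intro e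
            rw [volume_image_diagMap]
            refine le_trans (le_of_eq ?_) (mul_le_mul_right (hRv e) _)
            have hprod : |ℓ e 0 * ℓ e 1| = |ℓ e i| * |ℓ e k| := by
              have hk' : k = 0 ∧ i = 1 ∨ k = 1 ∧ i = 0 := by omega
              rcases hk' with ⟨rfl, rfl⟩ | ⟨rfl, rfl⟩
              · rw [abs_mul, mul_comm]
              · rw [abs_mul]
            rw [← ENNReal.ofReal_mul (by positivity), hprod]
            congr 1
            have h1 : |ℓ e k| ^ (t - 1) = |ℓ e k| / |ℓ e k| ^ (2 - t) := by
              rw [eq_div_iff (Real.rpow_pos_of_pos (hlpos e k) _).ne',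
                ← Real.rpow_add (hlpos e k)]
              norm_num
            rw [h1, Real.div_rpow hδ.le (hlpos e k).le]
            ring
          refine le_trans ?_ (Finset.sum_le_sum fun e _ => hle e)
          rw [← ENNReal.ofReal_sum_of_nonneg fun e _ => by positivity, ← Finset.mul_sum]
          refine ENNReal.ofReal_le_ofReal ?_
          exact le_mul_of_one_le_right (by positivity) hsum
        · intro e e' hee'
          exact (hdisj hee').mono (image_mono (hRU e)) (image_mono (hRU e'))
        · exact fun e => (hRm e).image_of_continuousOn_injOn
            (continuous_diagMap _ _).continuousOn (injective_diagMap _ (hℓ e)).injOn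
  refine ⟨c, hcpos, fun δ hδ hδ1 => ?_⟩
  have hne : Nonempty I := by
    by_contra hI
    rw [not_nonempty_iff] at hI
    simp at hsum
    linarith
  have hθ0 : 0 ≤ θ := (abs_nonneg _).trans (hθ hne.some)
  obtain ⟨n, hn⟩ := exists_pow_lt_of_lt_one hδ hθ1
  obtain ⟨R, -, -, hR, hv⟩ := main n δ hδ (hδ1.trans hB1) hn.le
  exact ⟨R, hR, hv⟩

/-- If greedy selection stops early, its points form a `δ`-net of `F`, so balls of radius `2δ`
around them cover the thickening; dividing its area by that of one ball still gives enough points.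
-/
theorem separatedRate_of_one_le_sum (hℓ : ∀ e j, ℓ e j ≠ 0)
    (hU : ∀ e, MapsTo (diagMap (ℓ e) (v e)) openSquare openSquare)
    (hdisj : Pairwise fun e e' => Disjoint (diagMap (ℓ e) (v e) '' openSquare)
      (diagMap (ℓ e') (v e') '' openSquare))
    (hF : ∀ e, MapsTo (diagMap (ℓ e) (v e)) F F) (hFK : F ⊆ unitSquare)
    {i k : Fin 2} (hik : i ≠ k) {θ : ℝ} (hθ1 : θ < 1) (hθ : ∀ e, |ℓ e k| ≤ θ)
    {a b : ℝ} (ha : 0 ≤ a) (hab : a < b) (hb : b ≤ 1) (hproj : ∀ x ∈ Ioo a b, ∃ w ∈ F, w i = x)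
    {t : ℝ} (ht : t ≤ 2) (hsum : 1 ≤ ∑ e, |ℓ e i| * |ℓ e k| ^ (t - 1)) :
    SeparatedRate F t := by
  obtain ⟨c, hc, h⟩ :=
    exists_volume_thickening hℓ hU hdisj hF hFK hik hθ1 hθ ha hab hb hproj ht hsum
  set V := volume (Metric.closedBall (0 : EuclideanSpace ℝ (Fin 2)) 1) with hV
  have hVtop : V ≠ ⊤ := measure_closedBall_lt_top.ne
  have hVpos : 0 < V.toReal := ENNReal.toReal_pos (Metric.measure_closedBall_pos _ _ one_pos).ne' hVtop
  refine ⟨c / (4 * V.toReal), by positivity, 1, one_pos, fun δ hδ hδ1 => ?_⟩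
  obtain ⟨T, hTF, hsep, hT⟩ := exists_separated_or_cover F hδ.le ⌈c / (4 * V.toReal) * δ ^ (-t)⌉₊
  refine ⟨T, hTF, hsep, ?_⟩
  rcases hT with hT | hT
  · exact (Nat.le_ceil _).trans (by exact_mod_cast hT)
  obtain ⟨R, hR, hRv⟩ := h δ hδ hδ1
  have hRT : R ⊆ ⋃ x ∈ T, Metric.closedBall x (2 * δ) := by
    intro z hz
    obtain ⟨w, hw, hwi, hwk⟩ := hR z hz
    obtain ⟨x, hx, hwx⟩ := hT w hw
    refine mem_iUnion₂.2 ⟨x, hx, ?_⟩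
    have h1 := dist_le_of_apply_eq hik hwi hwk
    have h2 := dist_triangle z w x
    rw [Metric.mem_closedBall]
    linarith
  have hvol := hRv.trans ((measure_mono hRT).trans (measure_biUnion_finset_le T _))
  have hball : ∀ x ∈ T, volume (Metric.closedBall x (2 * δ)) =
      ENNReal.ofReal ((2 * δ) ^ 2 * V.toReal) := by
    intro x _
    rw [Measure.addHaar_closedBall' _ _ (by positivity), finrank_euclideanSpace_fin,
      ENNReal.ofReal_mul (by positivity), ENNReal.ofReal_toReal hVtop]
  rw [Finset.sum_congr rfl hball, Finset.sum_const, nsmul_eq_mul, ← ENNReal.ofReal_natCast,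
    ← ENNReal.ofReal_mul (by positivity), ENNReal.ofReal_le_ofReal_iff (by positivity)] at hvol
  have h2 : δ ^ (2 - t) = δ ^ 2 * δ ^ (-t) := by
    rw [sub_eq_add_neg, Real.rpow_add hδ, Real.rpow_two]
  rw [h2] at hvol
  rw [div_mul_eq_mul_div, div_le_iff₀ (by positivity)]
  refine le_of_mul_le_mul_left ?_ (pow_pos hδ 2)
  calc δ ^ 2 * (c * δ ^ (-t)) = c * (δ ^ 2 * δ ^ (-t)) := by ring
    _ ≤ _ := hvol
    _ = _ := by ring

end DiagonalMap

/-! ### Upper bound by covers with boxes -/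

section Upper

variable {I : Type*} [Fintype I] {ℓ v : I → Fin 2 → ℝ} {F : Set (EuclideanSpace ℝ (Fin 2))}

/-- A box spanning the square in direction `k` only has to slide in direction `i`. -/
theorem exists_finset_cover_of_one_le {η : Fin 2 → ℝ} {i k : Fin 2} (hik : i ≠ k)
    (hη : 0 < η i) (hk : 1 ≤ η k) :
    ∃ T : Finset (Fin 2 → ℝ), (T.card : ℝ) ≤ (η i)⁻¹ + 1 ∧
      ∀ z ∈ unitSquare, ∃ c ∈ T, ∀ j, |z j - c j| ≤ η j := by
  classical
  refine ⟨(Finset.range (⌊(η i)⁻¹⌋₊ + 1)).image fun (m : ℕ) (j : Fin 2) =>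
    if j = i then (m : ℝ) * η i else 0,
    ?_, fun z hz => ⟨_, Finset.mem_image.2 ⟨⌊z i / η i⌋₊, Finset.mem_range.2 ?_, rfl⟩, fun j => ?_⟩⟩
  · refine le_trans (Nat.cast_le.2 Finset.card_image_le) ?_
    rw [Finset.card_range]
    push_cast
    linarith [Nat.floor_le (inv_nonneg.2 hη.le)]
  · refine Nat.lt_succ_of_le (Nat.floor_le_floor ?_)
    rw [div_eq_mul_inv]
    exact mul_le_of_le_one_left (inv_nonneg.2 hη.le) (hz i).2
  · by_cases hj : j = i
    · subst hj
      simp only [if_true]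
      have h1 := Nat.floor_le (div_nonneg (hz j).1 hη.le)
      have h2 := Nat.lt_floor_add_one (z j / η j)
      rw [le_div_iff₀ hη] at h1
      rw [div_lt_iff₀ hη] at h2
      rw [abs_le]
      constructor <;> linarith
    · have hjk : j = k := by omega
      subst hjk
      simp only [hj, if_false, sub_zero]
      rw [abs_of_nonneg (hz j).1]
      exact (hz j).2.trans hk

/-- A box of half-sides `η j` pulls back to one of half-sides `η j / |ℓ e j|`, which changes its
shape; hence the two free parameters. Each term of the bound is reproduced by this rescaling up to
one of the two sums, both at most 1. The recursion stops once a half-side reaches 1. -/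
theorem exists_finset_cover_boxes (hℓ : ∀ e j, ℓ e j ≠ 0) {θ : ℝ} (hθ : ∀ e j, |ℓ e j| ≤ θ)
    (hF : ∀ z ∈ F, ∃ e, ∃ w ∈ F, diagMap (ℓ e) (v e) w = z) (hFK : F ⊆ unitSquare)
    {t : ℝ} (ht : 1 ≤ t) (h0 : ∑ e, |ℓ e 0| * |ℓ e 1| ^ (t - 1) ≤ 1)
    (h1 : ∑ e, |ℓ e 1| * |ℓ e 0| ^ (t - 1) ≤ 1) :
    ∃ C > 0, ∀ n : ℕ, ∀ η : Fin 2 → ℝ, (∀ j, 0 < η j) → (∀ j, η j ≤ 1) → θ ^ n ≤ η 0 →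
      ∃ T : Finset (Fin 2 → ℝ),
        (T.card : ℝ) ≤ C * ((η 0)⁻¹ * (η 1) ^ (1 - t) + (η 1)⁻¹ * (η 0) ^ (1 - t)) ∧
        ∀ z ∈ F, ∃ c ∈ T, ∀ j, |z j - c j| ≤ η j := by
  classical
  have hlpos : ∀ e j, 0 < |ℓ e j| := fun e j => abs_pos.2 (hℓ e j)
  obtain ⟨B, hB1, hB⟩ : ∃ B : ℝ, 1 ≤ B ∧ ∀ e j, |ℓ e j|⁻¹ ≤ B := by
    obtain ⟨B, hB⟩ := (finite_range fun x : I × Fin 2 => |ℓ x.1 x.2|⁻¹).bddAbove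
    exact ⟨max 1 B, le_max_left _ _,
      fun e j => (hB (mem_range_self (e, j))).trans (le_max_right _ _)⟩
  have hB0 : 0 < B := by linarith
  set C := (1 + B) * B ^ (t - 1) with hC
  have hCpos : 0 < C := by positivity
  have base : ∀ (i k : Fin 2), i ≠ k → ∀ η : Fin 2 → ℝ, (∀ j, 0 < η j) → (∀ j, η j ≤ B) →
      1 ≤ η k → ∃ T : Finset (Fin 2 → ℝ),
        (T.card : ℝ) ≤ C * ((η i)⁻¹ * (η k) ^ (1 - t)) ∧
        ∀ z ∈ F, ∃ c ∈ T, ∀ j, |z j - c j| ≤ η j := by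
    intro i k hik η hη hηB hk
    obtain ⟨T, hT, hcov⟩ := exists_finset_cover_of_one_le hik (hη i) hk
    refine ⟨T, hT.trans ?_, fun z hz => hcov z (hFK hz)⟩
    have hi := hη i
    have h2 : 1 ≤ B * (η i)⁻¹ := by
      rw [← div_eq_mul_inv, le_div_iff₀ hi, one_mul]; exact hηB i
    have h3 : 1 ≤ B ^ (t - 1) * (η k) ^ (1 - t) := by
      rw [show 1 - t = -(t - 1) by ring, Real.rpow_neg (hη k).le, ← div_eq_mul_inv,
        le_div_iff₀ (Real.rpow_pos_of_pos (hη k) _), one_mul]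
      exact Real.rpow_le_rpow (hη k).le (hηB k) (by linarith)
    calc (η i)⁻¹ + 1 ≤ (1 + B) * (η i)⁻¹ := by linarith
      _ ≤ (1 + B) * (η i)⁻¹ * (B ^ (t - 1) * (η k) ^ (1 - t)) :=
          le_mul_of_one_le_right (by positivity) h3
      _ = C * ((η i)⁻¹ * (η k) ^ (1 - t)) := by rw [hC]; ring
  have main : ∀ n : ℕ, ∀ η : Fin 2 → ℝ, (∀ j, 0 < η j) → (∀ j, η j ≤ B) → θ ^ n ≤ η 0 →
      ∃ T : Finset (Fin 2 → ℝ),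
        (T.card : ℝ) ≤ C * ((η 0)⁻¹ * (η 1) ^ (1 - t) + (η 1)⁻¹ * (η 0) ^ (1 - t)) ∧
        ∀ z ∈ F, ∃ c ∈ T, ∀ j, |z j - c j| ≤ η j := by
    have hbase : ∀ η : Fin 2 → ℝ, (∀ j, 0 < η j) → (∀ j, η j ≤ B) → (1 ≤ η 0 ∨ 1 ≤ η 1) →
        ∃ T : Finset (Fin 2 → ℝ),
          (T.card : ℝ) ≤ C * ((η 0)⁻¹ * (η 1) ^ (1 - t) + (η 1)⁻¹ * (η 0) ^ (1 - t)) ∧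
          ∀ z ∈ F, ∃ c ∈ T, ∀ j, |z j - c j| ≤ η j := by
      intro η hη hηB h
      have hp0 := hη 0
      have hp1 := hη 1
      rcases h with h | h
      · obtain ⟨T, hT, hcov⟩ := base 1 0 (by decide) η hη hηB h
        refine ⟨T, hT.trans ?_, hcov⟩
        gcongr
        exact le_add_of_nonneg_left (by positivity)
      · obtain ⟨T, hT, hcov⟩ := base 0 1 (by decide) η hη hηB h
        refine ⟨T, hT.trans ?_, hcov⟩
        gcongr
        exact le_add_of_nonneg_right (by positivity)
    intro n
    induction n with
    | zero => exact fun η hη hηB h => hbase η hη hηB (Or.inl (by simpa using h))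
    | succ n ih =>
      intro η hη hηB hn
      by_cases hlarge : 1 ≤ η 0 ∨ 1 ≤ η 1
      · exact hbase η hη hηB hlarge
      push Not at hlarge
      have hη1 : ∀ j, η j ≤ 1 := by
        intro j
        fin_cases j
        · exact hlarge.1.le
        · exact hlarge.2.le
      have hstep : ∀ e, ∃ T : Finset (Fin 2 → ℝ), (T.card : ℝ) ≤
          C * ((η 0 / |ℓ e 0|)⁻¹ * (η 1 / |ℓ e 1|) ^ (1 - t) +
            (η 1 / |ℓ e 1|)⁻¹ * (η 0 / |ℓ e 0|) ^ (1 - t)) ∧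
          ∀ z ∈ F, ∃ c ∈ T, ∀ j, |z j - c j| ≤ η j / |ℓ e j| := by
        intro e
        refine ih (fun j => η j / |ℓ e j|) (fun j => div_pos (hη j) (hlpos e j)) (fun j => ?_) ?_
        · rw [div_eq_mul_inv]
          exact (mul_le_of_le_one_left (inv_nonneg.2 (abs_nonneg _)) (hη1 j)).trans (hB e j)
        · rw [le_div_iff₀ (hlpos e 0)]
          refine le_trans ?_ hn
          rw [pow_succ]
          have := (abs_nonneg _).trans (hθ e 0)
          exact mul_le_mul_of_nonneg_left (hθ e 0) (by positivity)
      choose T hT hcov using hstep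
      refine ⟨Finset.univ.biUnion fun e => (T e).image fun c j => ℓ e j * c j + v e j, ?_, ?_⟩
      · have hcard : ((Finset.univ.biUnion fun e =>
            (T e).image fun c j => ℓ e j * c j + v e j).card : ℝ) ≤ ∑ e, ((T e).card : ℝ) := by
          exact_mod_cast Finset.card_biUnion_le.trans
            (Finset.sum_le_sum fun e _ => Finset.card_image_le)
        refine hcard.trans ((Finset.sum_le_sum fun e _ => hT e).trans ?_)
        have hscale : ∀ (i k : Fin 2) e, (η i / |ℓ e i|)⁻¹ * (η k / |ℓ e k|) ^ (1 - t) =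
            ((η i)⁻¹ * (η k) ^ (1 - t)) * (|ℓ e i| * |ℓ e k| ^ (t - 1)) := by
          intro i k e
          rw [Real.div_rpow (hη k).le (hlpos e k).le, show 1 - t = -(t - 1) by ring,
            Real.rpow_neg (hlpos e k).le, div_inv_eq_mul, inv_div]
          ring
        simp only [hscale]
        rw [← Finset.mul_sum, Finset.sum_add_distrib, ← Finset.mul_sum, ← Finset.mul_sum]
        have hp0 := hη 0
        have hp1 := hη 1
        refine mul_le_mul_of_nonneg_left (add_le_add ?_ ?_) hCpos.le
        · exact mul_le_of_le_one_right (by positivity) h0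
        · exact mul_le_of_le_one_right (by positivity) h1
      · intro z hz
        obtain ⟨e, w, hw, rfl⟩ := hF z hz
        obtain ⟨c, hc, hwc⟩ := hcov e w hw
        refine ⟨_, Finset.mem_biUnion.2 ⟨e, Finset.mem_univ _, Finset.mem_image_of_mem _ hc⟩,
          fun j => ?_⟩
        have := hwc j
        rw [le_div_iff₀ (hlpos e j)] at this
        rw [diagMap_apply, add_sub_add_right_eq_sub, ← mul_sub, abs_mul, mul_comm]
        exact this
  exact ⟨C, hCpos, fun n η hη hη1 => main n η hη fun j => (hη1 j).trans hB1⟩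

theorem coverRate_of_sum_le_one (hℓ : ∀ e j, ℓ e j ≠ 0) {θ : ℝ} (hθ1 : θ < 1)
    (hθ : ∀ e j, |ℓ e j| ≤ θ)
    (hF : ∀ z ∈ F, ∃ e, ∃ w ∈ F, diagMap (ℓ e) (v e) w = z) (hFK : F ⊆ unitSquare)
    {t : ℝ} (ht : 1 ≤ t) (h0 : ∑ e, |ℓ e 0| * |ℓ e 1| ^ (t - 1) ≤ 1)
    (h1 : ∑ e, |ℓ e 1| * |ℓ e 0| ^ (t - 1) ≤ 1) : CoverRate F t := by
  classical
  obtain ⟨C, hC, h⟩ := exists_finset_cover_boxes hℓ hθ hF hFK ht h0 h1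
  refine ⟨2 * C * 4 ^ t, by positivity, 1, one_pos, fun δ hδ hδ1 => ?_⟩
  obtain ⟨n, hn⟩ := exists_pow_lt_of_lt_one (by positivity : 0 < δ / 4) hθ1
  -- Half-side `δ / 4` keeps coordinate differences below `δ / 2`, and the diameter is at most the
  -- sum of the two.
  obtain ⟨T, hT, hcov⟩ := h n (fun _ => δ / 4) (fun _ => by positivity) (fun _ => by linarith) hn.le
  set g : (Fin 2 → ℝ) → Set (EuclideanSpace ℝ (Fin 2)) := fun c => {z | ∀ j, |z j - c j| ≤ δ / 4}
  have hN : coverNumber δ F ≤ (T.card : ℕ∞) := by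
    refine (iInf_le_of_le (g '' T) (iInf₂_le_of_le ?_ ?_ le_rfl)).trans ?_
    · intro z hz
      obtain ⟨c, hc, hzc⟩ := hcov z hz
      exact ⟨g c, mem_image_of_mem g hc, hzc⟩
    · rintro _ ⟨c, -, rfl⟩
      refine Metric.ediam_le fun z hz w hw => ?_
      rw [edist_dist]
      refine ENNReal.ofReal_le_ofReal ?_
      have hj : ∀ j, |z j - w j| ≤ δ / 2 := by
        intro j
        have h1 := abs_le.1 (hz j)
        have h2 := abs_le.1 (hw j)
        rw [abs_le]
        constructor <;> linarith [h1.1, h1.2, h2.1, h2.2]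
      linarith [dist_le_of_forall_abs_le (hj 0) (hj 1)]
    · exact (encard_image_le g T).trans (Set.encard_coe_eq_coe_finsetCard T).le
  refine (ENat.toENNReal_le.2 hN).trans ?_
  rw [ENat.toENNReal_coe, ← ENNReal.ofReal_natCast]
  refine ENNReal.ofReal_le_ofReal (hT.trans (le_of_eq ?_))
  have h4 : (δ / 4) ^ (-t) = 4 ^ t * δ ^ (-t) := by
    rw [Real.div_rpow hδ.le (by norm_num), Real.rpow_neg (by norm_num : (0 : ℝ) ≤ 4), div_inv_eq_mul,
      mul_comm]
  have h5 : (δ / 4)⁻¹ * (δ / 4) ^ (1 - t) = (δ / 4) ^ (-t) := by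
    rw [← Real.rpow_neg_one, ← Real.rpow_add (by positivity)]
    congr 1
    ring
  simp only [h5, h4]
  ring

end Upper

/-! ### Singular values and convergence of the affinity series -/

section Affinity

theorem toEuclideanLin_diagonal_apply (d : Fin 2 → ℝ) (w : EuclideanSpace ℝ (Fin 2)) (i : Fin 2) :
    Matrix.toEuclideanLin (Matrix.diagonal d) w i = d i * w i := by
  fin_cases i <;> simp [Matrix.toLpLin_apply]

/-- Squared singular values are eigenvalues of the adjoint product, here the squared diagonal
matrix; a nonzero coordinate of an eigenvector identifies the entry. -/
theorem sq_singularValue_diagonal (d : Fin 2 → ℝ) {n : ℕ} (hn : n < 2) :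
    ∃ i, singularValue (Matrix.diagonal d) n ^ 2 = d i ^ 2 := by
  set T := Matrix.toEuclideanLin (Matrix.diagonal d) with hT
  have h := T.hasEigenvalue_adjoint_comp_self_sq_singularValues (n := n) (by simpa using hn)
  obtain ⟨w, hw⟩ := h.exists_hasEigenvector
  have hadj : T.adjoint = T := by
    rw [hT, ← Matrix.toEuclideanLin_conjTranspose_eq_adjoint]
    simp
  have hw1 := hw.apply_eq_smul
  have hw2 := hw.2
  rw [hadj] at hw1
  have hex : ∃ i, w i ≠ 0 := by
    by_contra hcon
    push Not at hcon
    exact hw2 (by ext i; simpa using hcon i)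
  obtain ⟨i, hi⟩ := hex
  refine ⟨i, ?_⟩
  have := congrArg (fun u : EuclideanSpace ℝ (Fin 2) => u i) hw1
  simp only [LinearMap.comp_apply, hT, toEuclideanLin_diagonal_apply, PiLp.smul_apply,
    smul_eq_mul, ← mul_assoc] at this
  have h2 := mul_right_cancel₀ hi this
  rw [sq (d i), h2]
  rfl

theorem singularValue_diagonal_mul (d : Fin 2 → ℝ) :
    singularValue (Matrix.diagonal d) 0 * singularValue (Matrix.diagonal d) 1 = |d 0 * d 1| := by
  have h := (Matrix.toEuclideanLin (Matrix.diagonal d)).normDet_eq_prod_singularValues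
  rw [LinearMap.normDet_eq_abs_det, det_toEuclideanLin_diagonal, finrank_euclideanSpace_fin,
    Finset.prod_range_succ, Finset.prod_range_one] at h
  exact h.symm

/-- Each singular value is one of `|d 0|`, `|d 1|`; their product and order leave only this
assignment. -/
theorem singularValue_diagonal (d : Fin 2 → ℝ) (hd : ∀ i, d i ≠ 0) :
    singularValue (Matrix.diagonal d) 0 = max |d 0| |d 1| ∧
      singularValue (Matrix.diagonal d) 1 = min |d 0| |d 1| := by
  have hmul := singularValue_diagonal_mul d
  have hanti : singularValue (Matrix.diagonal d) 1 ≤ singularValue (Matrix.diagonal d) 0 :=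
    LinearMap.singularValues_antitone _ zero_le_one
  have hmem : ∀ n < 2, singularValue (Matrix.diagonal d) n = |d 0| ∨
      singularValue (Matrix.diagonal d) n = |d 1| := by
    intro n hn
    obtain ⟨i, hi⟩ := sq_singularValue_diagonal d hn
    have h0 : 0 ≤ singularValue (Matrix.diagonal d) n := LinearMap.singularValues_nonneg _ _
    rw [sq_eq_sq_iff_abs_eq_abs, abs_of_nonneg h0] at hi
    fin_cases i
    · exact Or.inl hi
    · exact Or.inr hi
  have h0 := abs_pos.2 (hd 0)
  have h1 := abs_pos.2 (hd 1)
  rw [abs_mul] at hmul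
  rcases hmem 0 (by norm_num) with ha | ha <;> rcases hmem 1 (by norm_num) with hb | hb <;>
    rw [ha, hb] at hmul hanti ⊢
  · have := mul_left_cancel₀ h0.ne' hmul
    simp [this]
  · simp [hanti]
  · simp [hanti]
  · have := mul_right_cancel₀ h1.ne' hmul
    simp [this]

theorem singularValueFunction_of_le_one {r : ℝ} (hr : 0 < r) (hr1 : r ≤ 1) {d : Fin 2 → ℝ}
    (hd : ∀ i, d i ≠ 0) :
    singularValueFunction r (Matrix.diagonal d) = max |d 0| |d 1| ^ r := by
  have hceil : ⌈r⌉₊ = 1 := by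
    rw [Nat.ceil_eq_iff one_ne_zero]
    simpa using ⟨hr, hr1⟩
  rw [singularValueFunction, if_pos (by norm_num; linarith), hceil]
  simp [(singularValue_diagonal d hd).1]

theorem singularValueFunction_of_one_lt {r : ℝ} (hr : 1 < r) (hr2 : r ≤ 2) {d : Fin 2 → ℝ}
    (hd : ∀ i, d i ≠ 0) :
    singularValueFunction r (Matrix.diagonal d) = max |d 0| |d 1| * min |d 0| |d 1| ^ (r - 1) := by
  have hceil : ⌈r⌉₊ = 2 := by
    rw [Nat.ceil_eq_iff two_ne_zero]
    simpa using ⟨hr, hr2⟩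
  rw [singularValueFunction, if_pos (by norm_num; linarith), hceil]
  simp only [Nat.add_one_sub_one, Finset.prod_range_one, (singularValue_diagonal d hd).1,
    (singularValue_diagonal d hd).2, Nat.cast_ofNat]
  congr 2
  ring

theorem singularValueFunction_of_two_lt {r : ℝ} (hr : 2 < r) (d : Fin 2 → ℝ) :
    singularValueFunction r (Matrix.diagonal d) = (|d 0| * |d 1|) ^ (r / 2) := by
  rw [singularValueFunction, if_neg (by norm_num; linarith), Matrix.det_diagonal,
    Fin.prod_univ_two, abs_mul]
  norm_num

variable {I : Type*} {ℓ : I → Fin 2 → ℝ}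

theorem wordMatrix_diagonal (ℓ : I → Fin 2 → ℝ) {m : ℕ} (u : Fin m → I) :
    wordMatrix (fun e => Matrix.diagonal (ℓ e)) u = Matrix.diagonal fun j => ∏ k, ℓ (u k) j := by
  induction m with
  | zero => simp [wordMatrix]
  | succ m ih =>
    have := ih fun k => u k.succ
    rw [wordMatrix] at this ⊢
    rw [List.ofFn_succ, List.prod_cons, this, Matrix.diagonal_mul_diagonal]
    simp only [Fin.prod_univ_succ]

/-- The sum of `φ^r` over all non-empty words. -/
noncomputable def singularValueSum (r : ℝ) (L : I → Matrix (Fin 2) (Fin 2) ℝ) : ℝ≥0∞ :=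
  ∑' m : ℕ, ∑' u : Fin (m + 1) → I, ENNReal.ofReal (singularValueFunction r (wordMatrix L u))

theorem affinityDim_le {r : ℝ} (hr : 0 < r) {L : I → Matrix (Fin 2) (Fin 2) ℝ}
    (h : singularValueSum r L < ⊤) : affinityDim L ≤ (r : EReal) :=
  iInf_le_of_le r (iInf₂_le_of_le hr h le_rfl)

theorem le_affinityDim {t : EReal} {L : I → Matrix (Fin 2) (Fin 2) ℝ}
    (h : ∀ r : ℝ, 0 < r → singularValueSum r L < ⊤ → t ≤ (r : EReal)) : t ≤ affinityDim L :=
  le_iInf fun r => le_iInf₂ fun hr hs => h r hr hs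

theorem prod_abs_mul_rpow (ℓ : I → Fin 2 → ℝ) (i k : Fin 2) (s : ℝ) {m : ℕ} (u : Fin m → I) :
    ∏ n, (|ℓ (u n) i| * |ℓ (u n) k| ^ s) = |∏ n, ℓ (u n) i| * |∏ n, ℓ (u n) k| ^ s := by
  rw [Finset.prod_mul_distrib, Finset.abs_prod, Finset.abs_prod,
    Real.finsetProd_rpow _ _ fun n _ => abs_nonneg _]

variable [Fintype I]

theorem tsum_ofReal_prod {g : I → ℝ} (hg : ∀ e, 0 ≤ g e) (m : ℕ) :
    ∑' u : Fin m → I, ENNReal.ofReal (∏ k, g (u k)) = ENNReal.ofReal ((∑ e, g e) ^ m) := by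
  classical
  rw [tsum_fintype, Fintype.sum_pow, ENNReal.ofReal_sum_of_nonneg]
  exact fun u _ => Finset.prod_nonneg fun k _ => hg _

/-- A multiplicative minorant contributes `(∑ g) ^ (m + 1)` from words of length `m + 1`, which
would stay at least 1. -/
theorem sum_lt_one_of_singularValueSum_lt_top {r : ℝ} {L : I → Matrix (Fin 2) (Fin 2) ℝ}
    (h : singularValueSum r L < ⊤) {g : I → ℝ} (hg : ∀ e, 0 ≤ g e)
    (hle : ∀ (m : ℕ) (u : Fin (m + 1) → I),
      ∏ k, g (u k) ≤ singularValueFunction r (wordMatrix L u)) : ∑ e, g e < 1 := by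
  by_contra! hcon
  refine h.ne (top_unique ?_)
  calc (⊤ : ℝ≥0∞) = ∑' _ : ℕ, 1 := (ENNReal.tsum_const_eq_top_of_ne_zero one_ne_zero).symm
    _ ≤ ∑' m : ℕ, ∑' u : Fin (m + 1) → I, ENNReal.ofReal (∏ k, g (u k)) := by
        refine ENNReal.tsum_le_tsum fun m => ?_
        rw [tsum_ofReal_prod hg, ENNReal.one_le_ofReal]
        exact one_le_pow₀ hcon
    _ ≤ singularValueSum r L := ENNReal.tsum_le_tsum fun m => ENNReal.tsum_le_tsum fun u =>
        ENNReal.ofReal_le_ofReal (hle m u)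

theorem singularValueSum_lt_top {r : ℝ} {L : I → Matrix (Fin 2) (Fin 2) ℝ} {g h : I → ℝ}
    (hg : ∀ e, 0 ≤ g e) (hh : ∀ e, 0 ≤ h e) (hg1 : ∑ e, g e < 1) (hh1 : ∑ e, h e < 1)
    (hle : ∀ (m : ℕ) (u : Fin (m + 1) → I),
      singularValueFunction r (wordMatrix L u) ≤ ∏ k, g (u k) + ∏ k, h (u k)) :
    singularValueSum r L < ⊤ := by
  have hgeom : ∀ g : I → ℝ, (∀ e, 0 ≤ g e) → ∑ e, g e < 1 →
      ∑' m : ℕ, ∑' u : Fin (m + 1) → I, ENNReal.ofReal (∏ k, g (u k)) < ⊤ := by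
    intro g hg hg1
    simp_rw [tsum_ofReal_prod hg]
    have h0 : 0 ≤ ∑ e, g e := Finset.sum_nonneg fun e _ => hg e
    exact ((summable_nat_add_iff 1).2
      (summable_geometric_of_lt_one h0 hg1)).tsum_ofReal_ne_top.lt_top
  refine lt_of_le_of_lt ?_ (ENNReal.add_lt_top.2 ⟨hgeom g hg hg1, hgeom h hh hh1⟩)
  rw [← ENNReal.tsum_add]
  refine ENNReal.tsum_le_tsum fun m => ?_
  rw [← ENNReal.tsum_add]
  refine ENNReal.tsum_le_tsum fun u => ?_
  rw [← ENNReal.ofReal_add (Finset.prod_nonneg fun k _ => hg _)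
    (Finset.prod_nonneg fun k _ => hh _)]
  exact ENNReal.ofReal_le_ofReal (hle m u)

/-- For `a ≤ b` this amounts to `a^(1-s) ≤ b^(1-s)`. With `s = r - 1` it puts both multiplicative
weights below the singular value function. -/
theorem le_max_mul_min_rpow {a b s : ℝ} (ha : 0 < a) (hb : 0 < b) (hs : s ≤ 1) :
    a * b ^ s ≤ max a b * min a b ^ s := by
  rcases le_total b a with h | h
  · rw [max_eq_left h, min_eq_right h]
  · rw [max_eq_right h, min_eq_left h]
    have h1 : ∀ x : ℝ, 0 < x → x = x ^ s * x ^ (1 - s) := fun x hx => by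
      rw [← Real.rpow_add hx]; simp
    calc a * b ^ s = a ^ s * a ^ (1 - s) * b ^ s := by rw [← h1 a ha]
      _ ≤ a ^ s * b ^ (1 - s) * b ^ s := by
          gcongr
      _ = b ^ s * b ^ (1 - s) * a ^ s := by ring
      _ = b * a ^ s := by rw [← h1 b hb]

theorem sum_lt_one_of_one_lt (hℓ : ∀ e j, ℓ e j ≠ 0) {r : ℝ} (hr : 1 < r) (hr2 : r ≤ 2)
    (h : singularValueSum r (fun e => Matrix.diagonal (ℓ e)) < ⊤) :
    ∑ e, |ℓ e 0| * |ℓ e 1| ^ (r - 1) < 1 ∧ ∑ e, |ℓ e 1| * |ℓ e 0| ^ (r - 1) < 1 := by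
  constructor <;> refine sum_lt_one_of_singularValueSum_lt_top h (fun e => by positivity)
    fun m u => ?_ <;>
  · have hne : ∀ j, (∏ k, ℓ (u k) j) ≠ 0 := fun j => Finset.prod_ne_zero_iff.2 fun k _ => hℓ _ j
    rw [wordMatrix_diagonal, singularValueFunction_of_one_lt hr hr2 hne, prod_abs_mul_rpow]
    first
    | exact le_max_mul_min_rpow (abs_pos.2 (hne 0)) (abs_pos.2 (hne 1)) (by linarith)
    | rw [max_comm, min_comm]
      exact le_max_mul_min_rpow (abs_pos.2 (hne 1)) (abs_pos.2 (hne 0)) (by linarith)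

/-- For `r ≤ 1` the singular value function dominates `|ℓ 0|^r ≥ |ℓ 0|`, and the powers of `∑ |ℓ e
0|` do not decay. -/
theorem one_lt_of_singularValueSum_lt_top (hℓ : ∀ e j, ℓ e j ≠ 0) (hℓ1 : ∀ e, |ℓ e 0| ≤ 1)
    (hsum : 1 ≤ ∑ e, |ℓ e 0|) {r : ℝ} (hr : 0 < r)
    (h : singularValueSum r (fun e => Matrix.diagonal (ℓ e)) < ⊤) : 1 < r := by
  by_contra! hr1
  refine not_lt.2 hsum (sum_lt_one_of_singularValueSum_lt_top h (fun e => abs_nonneg _)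
    fun m u => ?_)
  have hne : ∀ j, (∏ k, ℓ (u k) j) ≠ 0 := fun j => Finset.prod_ne_zero_iff.2 fun k _ => hℓ _ j
  rw [wordMatrix_diagonal, singularValueFunction_of_le_one hr hr1 hne, ← Finset.abs_prod]
  have h1 : |∏ k, ℓ (u k) 0| ≤ 1 := by
    rw [Finset.abs_prod]
    exact Finset.prod_le_one (fun k _ => abs_nonneg _) fun k _ => hℓ1 _
  calc |∏ k, ℓ (u k) 0| ≤ |∏ k, ℓ (u k) 0| ^ r :=
        Real.self_le_rpow_of_le_one (abs_nonneg _) h1 hr1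
    _ ≤ _ := Real.rpow_le_rpow (abs_nonneg _) (le_max_left _ _) hr.le

theorem singularValueSum_lt_top_of_sum_lt_one (hℓ : ∀ e j, ℓ e j ≠ 0) {r : ℝ} (hr : 1 < r)
    (hr2 : r ≤ 2) (h0 : ∑ e, |ℓ e 0| * |ℓ e 1| ^ (r - 1) < 1)
    (h1 : ∑ e, |ℓ e 1| * |ℓ e 0| ^ (r - 1) < 1) :
    singularValueSum r (fun e => Matrix.diagonal (ℓ e)) < ⊤ := by
  refine singularValueSum_lt_top (fun e => by positivity) (fun e => by positivity) h0 h1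
    fun m u => ?_
  have hne : ∀ j, (∏ k, ℓ (u k) j) ≠ 0 := fun j => Finset.prod_ne_zero_iff.2 fun k _ => hℓ _ j
  rw [wordMatrix_diagonal, singularValueFunction_of_one_lt hr hr2 hne, prod_abs_mul_rpow,
    prod_abs_mul_rpow]
  rcases le_total |∏ n, ℓ (u n) 1| |∏ n, ℓ (u n) 0| with h | h
  · rw [max_eq_left h, min_eq_right h]
    exact le_add_of_nonneg_right (by positivity)
  · rw [max_eq_right h, min_eq_left h]
    exact le_add_of_nonneg_left (by positivity)

theorem singularValueSum_lt_top_of_two_lt (hℓ1 : ∀ e j, |ℓ e j| ≤ 1) {r : ℝ} (hr : 2 < r)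
    (h : ∑ e, |ℓ e 0| * |ℓ e 1| < 1) :
    singularValueSum r (fun e => Matrix.diagonal (ℓ e)) < ⊤ := by
  refine singularValueSum_lt_top (g := fun e => |ℓ e 0| * |ℓ e 1|) (h := fun _ => 0)
    (fun e => by positivity) (fun e => le_rfl) h (by simp) fun m u => ?_
  rw [wordMatrix_diagonal, singularValueFunction_of_two_lt hr, Finset.prod_mul_distrib,
    Finset.abs_prod, Finset.abs_prod]
  have hle : ∀ j, ∏ n, |ℓ (u n) j| ≤ 1 := fun j =>
    Finset.prod_le_one (fun k _ => abs_nonneg _) fun k _ => hℓ1 _ _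
  have hnn : ∀ j, 0 ≤ ∏ n, |ℓ (u n) j| := fun j => Finset.prod_nonneg fun k _ => abs_nonneg _
  refine (Real.rpow_le_self_of_le_one (mul_nonneg (hnn 0) (hnn 1))
    (mul_le_one₀ (hle 0) (hnn 1) (hle 1)) (by linarith)).trans ?_
  simp

end Affinity

/-! ### Dimension formula for diagonal systems -/

section Dimension

theorem isCompact_unitSquare : IsCompact unitSquare := by
  refine Metric.isCompact_of_isClosed_isBounded ?_ ?_
  · have : unitSquare = ⋂ i : Fin 2,
        {z : EuclideanSpace ℝ (Fin 2) | z i ∈ Icc (0 : ℝ) 1} := by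
      ext z; simp [unitSquare]
    rw [this]
    exact isClosed_iInter fun i => isClosed_Icc.preimage (by fun_prop)
  · refine Metric.isBounded_iff.2 ⟨1 + 1, fun z hz w hw => dist_le_of_forall_abs_le ?_ ?_⟩ <;>
    · rw [abs_le]
      constructor <;> linarith [(hz 0).1, (hz 0).2, (hw 0).1, (hw 0).2, (hz 1).1, (hz 1).2,
        (hw 1).1, (hw 1).2]

theorem unitSquare_nonempty : unitSquare.Nonempty := ⟨0, fun i => by simp⟩

variable {I : Type*} {ℓ v : I → Fin 2 → ℝ}

/-- Every point of `A` has a preimage in `A` under some coordinate map. Following preimages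
backwards produces a coding of `x`, and the nested images of the corresponding slices contain the
required point. -/
theorem exists_mem_limitSet_apply_eq
    (hK : ∀ e, MapsTo (diagMap (ℓ e) (v e)) unitSquare unitSquare) {i : Fin 2} {A : Set ℝ}
    (hA : A ⊆ Icc 0 1) (h : ∀ x ∈ A, ∃ e, ∃ x' ∈ A, ℓ e i * x' + v e i = x) {x : ℝ} (hx : x ∈ A) :
    ∃ w ∈ limitSet (fun e => diagMap (ℓ e) (v e)) unitSquare, w i = x := by
  choose e g hg hstep using fun x : A => h x x.2
  set xs : ℕ → A := fun n => (fun y : A => (⟨g y, hg y⟩ : A))^[n] ⟨x, hx⟩ with hxs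
  have hsucc : ∀ n, (xs (n + 1) : ℝ) = g (xs n) := fun n => by
    simp only [hxs, Function.iterate_succ_apply']
  obtain ⟨w, hw0, hw⟩ := exists_mem_iInter_prefixMap (f := fun e => diagMap (ℓ e) (v e))
    (K := unitSquare) (fun e => continuous_diagMap _ _) (fun n => e (xs n))
    (fun n => unitSquare ∩ {z | z i = xs n})
    (fun n => isCompact_unitSquare.inter_right (isClosed_eq (by fun_prop) continuous_const))
    (fun n => ⟨WithLp.toLp 2 fun _ => xs n, fun _ => hA (xs n).2, rfl⟩)
    (fun n => inter_subset_left)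
    (fun n z hz => ⟨hK _ hz.1, by
      have hzi : z i = xs (n + 1) := hz.2
      change ℓ _ i * z i + v _ i = _
      rw [hzi, hsucc]
      exact hstep (xs n)⟩)
  exact ⟨w, mem_iUnion.2 ⟨_, hw⟩, hw0.2⟩

/-- The box-counting and the packing dimension of a planar diagonal self-affine set satisfying the
rectangular open set condition are equal to the affinity dimension, if it projects onto the
horizontal side of the square, and either it projects onto a vertical interval or the sums
attached to the vertical direction are irrelevant. -/
theorem hasBoxDim_and_packingDim_eq_affinityDim [Fintype I] [Nonempty I]
    (hℓ : ∀ e j, ℓ e j ≠ 0) (hℓ1 : ∀ e j, |ℓ e j| < 1)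
    (hK : ∀ e, MapsTo (diagMap (ℓ e) (v e)) unitSquare unitSquare)
    (hU : ∀ e, MapsTo (diagMap (ℓ e) (v e)) openSquare openSquare)
    (hdisj : Pairwise fun e e' => Disjoint (diagMap (ℓ e) (v e) '' openSquare)
      (diagMap (ℓ e') (v e') '' openSquare))
    (harea : ∑ e, |ℓ e 0| * |ℓ e 1| < 1) (hwidth : 1 ≤ ∑ e, |ℓ e 0|)
    (hproj : ∀ x ∈ Ioo (0 : ℝ) 1,
      ∃ w ∈ limitSet (fun e => diagMap (ℓ e) (v e)) unitSquare, w 0 = x)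
    (hvert : ∑ e, |ℓ e 1| < 1 ∨ ∃ a b : ℝ, 0 ≤ a ∧ a < b ∧ b ≤ 1 ∧ ∀ y ∈ Ioo a b,
      ∃ w ∈ limitSet (fun e => diagMap (ℓ e) (v e)) unitSquare, w 1 = y) :
    HasBoxDim (limitSet (fun e => diagMap (ℓ e) (v e)) unitSquare)
        (affinityDim fun e => Matrix.diagonal (ℓ e)) ∧
      packingDim (limitSet (fun e => diagMap (ℓ e) (v e)) unitSquare) =
        affinityDim fun e => Matrix.diagonal (ℓ e) := by
  set f := fun e => diagMap (ℓ e) (v e) with hf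
  set F := limitSet f unitSquare with hFdef
  set d := affinityDim fun e => Matrix.diagonal (ℓ e) with hd
  have hFK : F ⊆ unitSquare := limitSet_subset
  have hFf : ∀ e, MapsTo (diagMap (ℓ e) (v e)) F F := mapsTo_limitSet hK
  obtain ⟨θ, hθ1, hθ⟩ : ∃ θ < 1, ∀ e j, |ℓ e j| ≤ θ := by
    obtain ⟨x, hx⟩ := Finite.exists_max fun x : I × Fin 2 => |ℓ x.1 x.2|
    exact ⟨_, hℓ1 x.1 x.2, fun e j => hx (e, j)⟩
  obtain ⟨c, hc, hcℓ⟩ : ∃ c > 0, ∀ e j, c ≤ |ℓ e j| := by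
    obtain ⟨x, hx⟩ := Finite.exists_min fun x : I × Fin 2 => |ℓ x.1 x.2|
    exact ⟨_, abs_pos.2 (hℓ x.1 x.2), fun e j => hx (e, j)⟩
  have hθ0 : 0 ≤ θ := (abs_nonneg _).trans (hθ (Classical.arbitrary I) 0)
  have hsepx : ∀ t ≤ 2, 1 ≤ ∑ e, |ℓ e 0| * |ℓ e 1| ^ (t - 1) → SeparatedRate F t := fun t ht h =>
    separatedRate_of_one_le_sum hℓ hU hdisj hFf hFK (by decide : (0 : Fin 2) ≠ 1) hθ1
      (fun e => hθ e 1) le_rfl one_pos le_rfl hproj ht h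
  have hsep1 : SeparatedRate F 1 := hsepx 1 (by norm_num) (by simpa using hwidth)
  -- Below the affinity dimension the series diverges, so one of the two sums is at least 1. If it
  -- is only the vertical one, `hvert` either contradicts this, as `|ℓ e 0|^(t-1) ≤ 1`, or provides
  -- the projection needed.
  have hsep : ∀ t : ℝ, 1 < t → (t : EReal) < d → SeparatedRate F t := by
    intro t ht htd
    have hinf : ¬ singularValueSum t (fun e => Matrix.diagonal (ℓ e)) < ⊤ := fun h =>
      not_lt.2 (affinityDim_le (by linarith) h) htd
    have ht2 : t ≤ 2 := by
      by_contra! ht2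
      exact hinf (singularValueSum_lt_top_of_two_lt (fun e j => (hℓ1 e j).le) ht2 harea)
    by_cases h0 : 1 ≤ ∑ e, |ℓ e 0| * |ℓ e 1| ^ (t - 1)
    · exact hsepx t ht2 h0
    have h1 : 1 ≤ ∑ e, |ℓ e 1| * |ℓ e 0| ^ (t - 1) := by
      by_contra! h1
      exact hinf (singularValueSum_lt_top_of_sum_lt_one hℓ ht ht2 (not_le.1 h0) h1)
    rcases hvert with hvert | ⟨a, b, ha, hab, hb, hy⟩
    · refine absurd (h1.trans (Finset.sum_le_sum fun e _ => ?_)) (not_le.2 hvert)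
      exact mul_le_of_le_one_right (abs_nonneg _)
        (Real.rpow_le_one (abs_nonneg _) (hℓ1 e 0).le (by linarith))
    · exact separatedRate_of_one_le_sum hℓ hU hdisj hFf hFK (by decide : (1 : Fin 2) ≠ 0) hθ1
        (fun e => hθ e 0) ha hab hb hy ht2 h1
  have hlow : ∀ D : EReal, (∀ t : ℝ, SeparatedRate F t → (t : EReal) ≤ D) → d ≤ D := by
    intro D hD
    refine (EReal.ge_of_forall_gt_iff_ge).1 fun t ht => ?_
    rcases le_or_gt t 1 with h1 | h1
    · exact le_trans (by exact_mod_cast h1) (hD 1 hsep1)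
    · exact hD t (hsep t h1 ht)
  have hcover : ∀ r : ℝ, 0 < r → singularValueSum r (fun e => Matrix.diagonal (ℓ e)) < ⊤ →
      ∃ r' ≤ r, 0 ≤ r' ∧ CoverRate F r' := by
    intro r hr h
    have hr1 := one_lt_of_singularValueSum_lt_top hℓ (fun e => (hℓ1 e 0).le) hwidth hr h
    have hFsub := limitSet_subset_iUnion (f := f) (K := unitSquare)
      fun e => injective_diagMap (v e) (hℓ e)
    rcases le_or_gt r 2 with hr2 | hr2
    · obtain ⟨h0, h1⟩ := sum_lt_one_of_one_lt hℓ hr1 hr2 h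
      exact ⟨r, le_rfl, hr.le,
        coverRate_of_sum_le_one hℓ hθ1 hθ hFsub hFK hr1.le h0.le h1.le⟩
    -- Above 2 exponent 2 suffices: there both sums are the total area of the rectangles.
    · refine ⟨2, hr2.le, zero_le_two,
        coverRate_of_sum_le_one hℓ hθ1 hθ hFsub hFK one_le_two ?_ ?_⟩
      · norm_num
        exact harea.le
      · norm_num
        simpa only [mul_comm] using harea.le
  have hup : upperBoxDim F ≤ d := le_affinityDim fun r hr h => by
    obtain ⟨r', hr', -, hC⟩ := hcover r hr h
    exact hC.upperBoxDim_le.trans (by exact_mod_cast hr')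
  have hpack : packingDim F ≤ d := le_affinityDim fun r hr h => by
    obtain ⟨r', hr', h0, hC⟩ := hcover r hr h
    exact (hC.packingDim_le h0).trans (by exact_mod_cast hr')
  have hlowbox : d ≤ lowerBoxDim F := hlow _ fun t ht => ht.le_lowerBoxDim
  have hlowpack : d ≤ packingDim F := hlow _ fun t ht =>
    ht.le_packingDim_limitSet isCompact_unitSquare unitSquare_nonempty hK hθ0 hθ1
      (fun e => dist_diagMap_le (hθ e)) hc (fun e => le_dist_diagMap hc.le (hcℓ e))
  exact ⟨⟨le_antisymm ((lowerBoxDim_le_upperBoxDim F).trans hup) hlowbox,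
    le_antisymm hup (hlowbox.trans (lowerBoxDim_le_upperBoxDim F))⟩, le_antisymm hpack hlowpack⟩

end Dimension

/-! ### Geometry of the digits -/

section Digits

/-- The diagonal entries of `L^p_{s,d}`. -/
noncomputable def digitRatio (p : ℝ) (e : ℕ × ℕ) : Fin 2 → ℝ :=
  ![p ^ (1 - e.1) * (1 - p) ^ e.1, (-1) ^ e.1 * (1 / ((e.2 : ℝ) * ((e.2 : ℝ) - 1)))]

theorem linPart_eq_diagonal (p : ℝ) (e : ℕ × ℕ) :
    linPart p e = Matrix.diagonal (digitRatio p e) := by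
  ext i j
  fin_cases i <;> fin_cases j <;> simp [linPart, digitRatio]

theorem affMap_eq_diagMap (p : ℝ) (e : ℕ × ℕ) :
    affMap p e = diagMap (digitRatio p e) (transPart p e) := by
  funext z
  ext i
  fin_cases i <;> simp [affMap, diagMap, linPart, digitRatio, dotProduct] <;> rfl

variable {p : ℝ} {e : ℕ × ℕ}

theorem abs_digitRatio_zero (hp : p ∈ Ioo (0 : ℝ) 1) (e : ℕ × ℕ) :
    |digitRatio p e 0| = p ^ (1 - e.1) * (1 - p) ^ e.1 := by
  have h0 := hp.1
  have h1 : 0 < 1 - p := by linarith [hp.2]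
  exact abs_of_pos (by simp only [digitRatio, Matrix.cons_val_zero]; positivity)

theorem abs_digitRatio_one (p : ℝ) (he : e ∈ ({0, 1} : Set ℕ) ×ˢ Ici 2) :
    |digitRatio p e 1| = 1 / ((e.2 : ℝ) * ((e.2 : ℝ) - 1)) := by
  have hd : (2 : ℝ) ≤ e.2 := by exact_mod_cast he.2
  have h1 : 0 < (e.2 : ℝ) - 1 := by linarith
  have : 0 < 1 / ((e.2 : ℝ) * ((e.2 : ℝ) - 1)) := by positivity
  simp only [digitRatio, Matrix.cons_val_one, Matrix.cons_val_fin_one, abs_mul, abs_pow, abs_neg,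
    abs_one, one_pow, one_mul]
  exact abs_of_pos this

theorem digitRatio_ne_zero (hp : p ∈ Ioo (0 : ℝ) 1) (he : e ∈ ({0, 1} : Set ℕ) ×ˢ Ici 2)
    (j : Fin 2) : digitRatio p e j ≠ 0 := by
  have h0 := hp.1
  have h1 : 0 < 1 - p := by linarith [hp.2]
  have hd : (2 : ℝ) ≤ e.2 := by exact_mod_cast he.2
  have h2 : 0 < (e.2 : ℝ) - 1 := by linarith
  rw [← abs_pos]
  fin_cases j
  · simp only [Fin.zero_eta, abs_digitRatio_zero hp]
    positivity
  · simp only [Fin.mk_one, abs_digitRatio_one p he]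
    positivity

theorem abs_digitRatio_lt_one (hp : p ∈ Ioo (0 : ℝ) 1) (he : e ∈ ({0, 1} : Set ℕ) ×ˢ Ici 2)
    (j : Fin 2) : |digitRatio p e j| < 1 := by
  have hd : (2 : ℝ) ≤ e.2 := by exact_mod_cast he.2
  fin_cases j
  · simp only [Fin.zero_eta, abs_digitRatio_zero hp]
    have h : e.1 = 0 ∨ e.1 = 1 := he.1
    rcases h with h | h <;> simp [h, hp.1, hp.2]
  · simp only [Fin.mk_one, abs_digitRatio_one p he]
    rw [div_lt_one (by nlinarith)]
    nlinarith

theorem one_div_mul_sub_one {d : ℝ} (hd : 2 ≤ d) :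
    1 / (d * (d - 1)) = 1 / (d - 1) - 1 / d := by
  have h1 : d - 1 ≠ 0 := by linarith
  have h2 : d ≠ 0 := by linarith
  field_simp
  ring

/-- The image of the open square lies in the rectangle of the digit. -/
theorem diagMap_digit_mem_Ioo (hp : p ∈ Ioo (0 : ℝ) 1) (he : e ∈ ({0, 1} : Set ℕ) ×ˢ Ici 2)
    {z : EuclideanSpace ℝ (Fin 2)} (hz : z ∈ openSquare) :
    diagMap (digitRatio p e) (transPart p e) z 0 ∈
        Ioo ((e.1 : ℝ) * p) (p + (e.1 : ℝ) * (1 - p)) ∧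
      diagMap (digitRatio p e) (transPart p e) z 1 ∈ Ioo (1 / (e.2 : ℝ)) (1 / ((e.2 : ℝ) - 1)) := by
  have hd : (2 : ℝ) ≤ e.2 := by exact_mod_cast he.2
  have hq := one_div_mul_sub_one hd
  have hq0 : 0 < 1 / ((e.2 : ℝ) * ((e.2 : ℝ) - 1)) := one_div_pos.2 (by nlinarith)
  have hz0 := hz 0
  have hz1 := hz 1
  obtain ⟨hp0, hp1⟩ := hp
  rw [diagMap_apply, diagMap_apply]
  rcases he.1 with h | h
  · have h : e.1 = 0 := h
    simp only [digitRatio, transPart, h, Matrix.cons_val_zero, Matrix.cons_val_one,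
      Matrix.cons_val_fin_one, mem_Ioo]
    norm_num only [pow_zero, pow_one, Nat.cast_zero, sub_zero]
    refine ⟨⟨?_, ?_⟩, ?_, ?_⟩ <;> nlinarith [hz0.1, hz0.2, hz1.1, hz1.2]
  · have h : e.1 = 1 := h
    simp only [digitRatio, transPart, h, Matrix.cons_val_zero, Matrix.cons_val_one,
      Matrix.cons_val_fin_one, mem_Ioo]
    norm_num only [pow_zero, pow_one, Nat.cast_one]
    refine ⟨⟨?_, ?_⟩, ?_, ?_⟩ <;> nlinarith [hz0.1, hz0.2, hz1.1, hz1.2]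

theorem mapsTo_digit_openSquare (hp : p ∈ Ioo (0 : ℝ) 1)
    (he : e ∈ ({0, 1} : Set ℕ) ×ˢ Ici 2) :
    MapsTo (diagMap (digitRatio p e) (transPart p e)) openSquare openSquare := by
  intro z hz j
  obtain ⟨h0, h1⟩ := diagMap_digit_mem_Ioo hp he hz
  have hd : (2 : ℝ) ≤ e.2 := by exact_mod_cast he.2
  obtain ⟨hp0, hp1⟩ := hp
  fin_cases j
  · refine ⟨lt_of_le_of_lt (by positivity) h0.1, h0.2.trans_le ?_⟩
    have h : e.1 = 0 ∨ e.1 = 1 := he.1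
    rcases h with h | h <;> simp [h, hp1.le]
  · refine ⟨lt_trans (by positivity) h1.1, h1.2.trans_le ?_⟩
    rw [div_le_one (by linarith)]
    linarith

/-- Slide each point towards the centre. Invariance of the closed square then follows from that of
the open one by continuity. -/
theorem unitSquare_subset_closure_openSquare : unitSquare ⊆ closure openSquare := by
  intro z hz
  rw [mem_closure_iff_seq_limit]
  set c : EuclideanSpace ℝ (Fin 2) := WithLp.toLp 2 fun _ => 1 / 2
  refine ⟨fun n : ℕ => z + (1 / ((n : ℝ) + 2)) • (c - z), fun n j => ?_, ?_⟩
  · have hn : (0 : ℝ) < 1 / ((n : ℝ) + 2) := by positivity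
    have hn1 : 1 / ((n : ℝ) + 2) < 1 := by
      rw [div_lt_one (by positivity)]
      linarith [(Nat.cast_nonneg n : (0 : ℝ) ≤ n)]
    have hzj := hz j
    have : (z + (1 / ((n : ℝ) + 2)) • (c - z)) j = z j + 1 / ((n : ℝ) + 2) * (1 / 2 - z j) := rfl
    rw [this]
    constructor <;> nlinarith [hzj.1, hzj.2]
  · have h : Tendsto (fun n : ℕ => 1 / ((n : ℝ) + 2)) atTop (𝓝 0) := by
      refine tendsto_const_nhds.div_atTop ?_
      exact tendsto_atTop_add_const_right _ _ tendsto_natCast_atTop_atTop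
    simpa using tendsto_const_nhds.add (h.smul_const (c - z))

theorem openSquare_subset_unitSquare : openSquare ⊆ unitSquare := fun _ hz i =>
  Ioo_subset_Icc_self (hz i)

theorem mapsTo_digit_unitSquare (hp : p ∈ Ioo (0 : ℝ) 1)
    (he : e ∈ ({0, 1} : Set ℕ) ×ˢ Ici 2) :
    MapsTo (diagMap (digitRatio p e) (transPart p e)) unitSquare unitSquare := by
  intro z hz
  have h := (mapsTo_digit_openSquare hp he).closure (continuous_diagMap _ _)
    (unitSquare_subset_closure_openSquare hz)
  exact closure_minimal openSquare_subset_unitSquare isCompact_unitSquare.isClosed h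

/-- Different `d` give disjoint horizontal strips `(1/d, 1/(d-1))`; with equal `d`, the two values
of `s` give columns on either side of `p`. -/
theorem disjoint_digit_image {e' : ℕ × ℕ} (hp : p ∈ Ioo (0 : ℝ) 1)
    (he : e ∈ ({0, 1} : Set ℕ) ×ˢ Ici 2) (he' : e' ∈ ({0, 1} : Set ℕ) ×ˢ Ici 2) (hne : e ≠ e') :
    Disjoint (diagMap (digitRatio p e) (transPart p e) '' openSquare)
      (diagMap (digitRatio p e') (transPart p e') '' openSquare) := by
  wlog hlt : e.2 < e'.2 ∨ e.2 = e'.2 ∧ e.1 < e'.1 generalizing e e'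
  · refine (this he' he hne.symm ?_).symm
    have : e.1 ≠ e'.1 ∨ e.2 ≠ e'.2 := by
      by_contra! h
      exact hne (Prod.ext h.1 h.2)
    omega
  rw [Set.disjoint_left]
  rintro _ ⟨z, hz, rfl⟩ ⟨w, hw, hwz⟩
  obtain ⟨hz0, hz1⟩ := diagMap_digit_mem_Ioo hp he hz
  obtain ⟨hw0, hw1⟩ := diagMap_digit_mem_Ioo hp he' hw
  rw [hwz] at hw0 hw1
  rcases hlt with hlt | ⟨-, hlt⟩
  · have hd : (2 : ℝ) ≤ e.2 := by exact_mod_cast he.2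
    have hdd : (e.2 : ℝ) ≤ (e'.2 : ℝ) - 1 := by
      have : ((e.2 + 1 : ℕ) : ℝ) ≤ e'.2 := by exact_mod_cast hlt
      push_cast at this
      linarith
    have := one_div_le_one_div_of_le (by linarith) hdd
    linarith [hz1.1, hw1.2]
  · have h1 : e.1 = 0 ∧ e'.1 = 1 := by
      have h : e.1 = 0 ∨ e.1 = 1 := he.1
      have h' : e'.1 = 0 ∨ e'.1 = 1 := he'.1
      omega
    rw [h1.1] at hz0
    rw [h1.2] at hw0
    norm_num at hz0 hw0
    linarith [hz0.2, hw0.1]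

theorem sum_Ico_one_div_mul_sub_one {m : ℕ} (hm : 2 ≤ m) (n : ℕ) :
    ∑ d ∈ Finset.Ico m (m + n), 1 / ((d : ℝ) * ((d : ℝ) - 1)) =
      1 / ((m : ℝ) - 1) - 1 / ((m : ℝ) + n - 1) := by
  induction n with
  | zero => simp
  | succ n ih =>
    have h2 : (2 : ℝ) ≤ m := by exact_mod_cast hm
    rw [← add_assoc, Finset.sum_Ico_succ_top (by omega), ih, one_div_mul_sub_one]
    · push_cast
      ring
    · push_cast
      linarith [(Nat.cast_nonneg n : (0 : ℝ) ≤ n)]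

/-- The series telescopes to `1/(m-1)`, and a finite `J` misses a positive tail. With `m = 2` and
weights `p`, `1 - p` this bounds the area; with `m = 3` and weights 1 it bounds the vertical sum by
`2 · 1/2`. -/
theorem sum_digits_lt {J : Set (ℕ × ℕ)} [Fintype J] {m : ℕ} (hm : 2 ≤ m)
    (hJ : J ⊆ ({0, 1} : Set ℕ) ×ˢ Ici m) {g : ℕ → ℝ} (hg : ∀ s, 0 < g s) :
    ∑ e : J, g (e : ℕ × ℕ).1 * (1 / (((e : ℕ × ℕ).2 : ℝ) * (((e : ℕ × ℕ).2 : ℝ) - 1))) <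
      (g 0 + g 1) * (1 / ((m : ℝ) - 1)) := by
  have hm2 : (2 : ℝ) ≤ m := by exact_mod_cast hm
  -- A crude upper bound for all second digits in `J`.
  set N := ∑ e : J, (e : ℕ × ℕ).2 with hN
  have hsub : J.toFinset ⊆ ({0, 1} : Finset ℕ) ×ˢ Finset.Ico m (m + (N + 1)) := by
    intro e he
    have he : e ∈ J := by simpa using he
    have h1 : e.2 ≤ N := Finset.single_le_sum (f := fun e : J => (e : ℕ × ℕ).2)
      (fun _ _ => Nat.zero_le _) (Finset.mem_univ (⟨e, he⟩ : J))
    have h2 : m ≤ e.2 := (hJ he).2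
    have h3 := (hJ he).1
    simp only [Finset.mem_product, Finset.mem_Ico]
    exact ⟨by simpa using h3, h2, by omega⟩
  have hpos : 0 < 1 / ((m : ℝ) + (N + 1 : ℕ) - 1) := by
    push_cast
    refine one_div_pos.2 ?_
    linarith [(Nat.cast_nonneg N : (0 : ℝ) ≤ N)]
  rw [Finset.sum_set_coe J (f := fun e : ℕ × ℕ =>
    g e.1 * (1 / ((e.2 : ℝ) * ((e.2 : ℝ) - 1))))]
  refine lt_of_le_of_lt (Finset.sum_le_sum_of_subset_of_nonneg hsub fun e he _ => ?_) ?_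
  · have h : m ≤ e.2 := (Finset.mem_Ico.1 (Finset.mem_product.1 he).2).1
    have h2 : (m : ℝ) ≤ e.2 := by exact_mod_cast h
    have h3 := hg e.1
    have : 0 ≤ (e.2 : ℝ) * ((e.2 : ℝ) - 1) := by nlinarith
    positivity
  · rw [Finset.sum_product]
    simp only [← Finset.mul_sum]
    rw [sum_Ico_one_div_mul_sub_one hm, ← Finset.sum_mul, Finset.sum_pair zero_ne_one]
    exact mul_lt_mul_of_pos_left (by linarith) (add_pos (hg 0) (hg 1))

theorem sum_abs_digitRatio_mul_lt_one {J : Set (ℕ × ℕ)} [Fintype J] (hp : p ∈ Ioo (0 : ℝ) 1)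
    (hJ : J ⊆ ({0, 1} : Set ℕ) ×ˢ Ici 2) :
    ∑ e : J, |digitRatio p e 0| * |digitRatio p e 1| < 1 := by
  have h0 := hp.1
  have h1 : 0 < 1 - p := by linarith [hp.2]
  have h := sum_digits_lt le_rfl hJ (g := fun s => p ^ (1 - s) * (1 - p) ^ s)
    fun s => by positivity
  rw [show ((fun s => p ^ (1 - s) * (1 - p) ^ s : ℕ → ℝ) 0 +
    (fun s => p ^ (1 - s) * (1 - p) ^ s : ℕ → ℝ) 1) * (1 / (((2 : ℕ) : ℝ) - 1)) = 1 by
      norm_num] at h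
  refine lt_of_eq_of_lt (Finset.sum_congr rfl fun e _ => ?_) h
  rw [abs_digitRatio_zero hp, abs_digitRatio_one p (hJ e.2)]

theorem sum_abs_digitRatio_one_lt_one {J : Set (ℕ × ℕ)} [Fintype J]
    (hJ : J ⊆ ({0, 1} : Set ℕ) ×ˢ Ici 3) : ∑ e : J, |digitRatio p e 1| < 1 := by
  have h := sum_digits_lt (by norm_num) hJ (g := fun _ => 1) fun s => one_pos
  norm_num only at h
  refine lt_of_eq_of_lt (Finset.sum_congr rfl fun e _ => ?_) h
  have he := hJ e.2
  rw [abs_digitRatio_one p ⟨he.1, le_trans (by norm_num) (mem_Ici.1 he.2)⟩, one_mul]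

theorem one_le_sum_abs_digitRatio_zero {J : Set (ℕ × ℕ)} [Fintype J] (hp : p ∈ Ioo (0 : ℝ) 1)
    {d₀ d₁ : ℕ} (h₀ : (0, d₀) ∈ J) (h₁ : (1, d₁) ∈ J) : 1 ≤ ∑ e : J, |digitRatio p e 0| := by
  classical
  have hne : (⟨_, h₀⟩ : J) ≠ ⟨_, h₁⟩ := fun h => by
    simpa using congrArg (fun e : J => (e : ℕ × ℕ).1) h
  have h := Finset.sum_le_univ_sum_of_nonneg (s := {(⟨_, h₀⟩ : J), ⟨_, h₁⟩})
    (f := fun e : J => |digitRatio p e 0|) fun e => abs_nonneg _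
  rw [Finset.sum_pair hne, abs_digitRatio_zero hp, abs_digitRatio_zero hp] at h
  simpa using h

theorem exists_digit_horizontal {J : Set (ℕ × ℕ)} (hp : p ∈ Ioo (0 : ℝ) 1)
    {d₀ d₁ : ℕ} (h₀ : (0, d₀) ∈ J) (h₁ : (1, d₁) ∈ J) {x : ℝ} (hx : x ∈ Icc (0 : ℝ) 1) :
    ∃ e : J, ∃ x' ∈ Icc (0 : ℝ) 1, digitRatio p e 0 * x' + transPart p e 0 = x := by
  have hp0 := hp.1
  have hp1 : 0 < 1 - p := by linarith [hp.2]
  rcases le_total x p with h | h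
  · refine ⟨⟨_, h₀⟩, x / p, ⟨div_nonneg hx.1 hp0.le, (div_le_one hp0).2 h⟩, ?_⟩
    simp [digitRatio, transPart, mul_div_cancel₀ _ hp0.ne']
  · refine ⟨⟨_, h₁⟩, (x - p) / (1 - p), ⟨div_nonneg (by linarith) hp1.le,
      (div_le_one hp1).2 (by linarith [hx.2])⟩, ?_⟩
    simp [digitRatio, transPart, mul_div_cancel₀ _ hp1.ne']

/-- The digit `(1, 2)` acts as `y ↦ 1 - y/2` and `(0, 2)` as `y ↦ (1 + y)/2`; they map `[1/2, 1]`
onto `[1/2, 3/4]` and `[3/4, 1]`. -/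
theorem exists_digit_vertical {J : Set (ℕ × ℕ)} (h₀ : (0, 2) ∈ J) (h₁ : (1, 2) ∈ J) {y : ℝ}
    (hy : y ∈ Icc (1 / 2 : ℝ) 1) :
    ∃ e : J, ∃ y' ∈ Icc (1 / 2 : ℝ) 1, digitRatio p e 1 * y' + transPart p e 1 = y := by
  rcases le_total y (3 / 4) with h | h
  · refine ⟨⟨_, h₁⟩, 2 - 2 * y, ⟨by linarith, by linarith [hy.1]⟩, ?_⟩
    simp only [digitRatio, transPart, Matrix.cons_val_one, Matrix.cons_val_fin_one]
    norm_num
    ring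
  · refine ⟨⟨_, h₀⟩, 2 * y - 1, ⟨by linarith, by linarith [hy.2]⟩, ?_⟩
    simp only [digitRatio, transPart, Matrix.cons_val_one, Matrix.cons_val_fin_one]
    norm_num
    ring

end Digits

end SignedLuroth

theorem mainTheorem11 (J : Set (ℕ × ℕ)) (hJ : J ⊆ ({0, 1} : Set ℕ) ×ˢ Set.Ici 2)
    (hfin : J.Finite)
    (hcase : (Prod.snd '' J ⊆ Set.Ici 3 ∧ Prod.fst '' J = {0, 1}) ∨
      ({(0, 2), (1, 2)} : Set (ℕ × ℕ)) ⊆ J)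
    (p : ℝ) (hp : p ∈ Set.Ioo (0 : ℝ) 1) :
    SignedLuroth.HasBoxDim (SignedLuroth.selfAffineSet p J)
        (SignedLuroth.affinityDim fun e : J => SignedLuroth.linPart p (e : ℕ × ℕ)) ∧
      SignedLuroth.packingDim (SignedLuroth.selfAffineSet p J) =
        SignedLuroth.affinityDim fun e : J => SignedLuroth.linPart p (e : ℕ × ℕ) := by
  open SignedLuroth in
  have : Fintype J := hfin.fintype
  have hdig : ∃ d₀ d₁ : ℕ, (0, d₀) ∈ J ∧ (1, d₁) ∈ J := by
    rcases hcase with ⟨-, h⟩ | h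
    · obtain ⟨⟨s₀, d₀⟩, h₀, hs₀⟩ : (0 : ℕ) ∈ Prod.fst '' J := by rw [h]; simp
      obtain ⟨⟨s₁, d₁⟩, h₁, hs₁⟩ : (1 : ℕ) ∈ Prod.fst '' J := by rw [h]; simp
      exact ⟨d₀, d₁, hs₀ ▸ h₀, hs₁ ▸ h₁⟩
    · exact ⟨2, 2, h (by simp), h (by simp)⟩
  obtain ⟨d₀, d₁, h₀, h₁⟩ := hdig
  have : Nonempty J := ⟨⟨_, h₀⟩⟩
  have hK : ∀ e : J, MapsTo (diagMap (digitRatio p e) (transPart p e)) unitSquare unitSquare :=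
    fun e => mapsTo_digit_unitSquare hp (hJ e.2)
  simp only [selfAffineSet, linPart_eq_diagonal, affMap_eq_diagMap]
  refine hasBoxDim_and_packingDim_eq_affinityDim (I := J) (ℓ := fun e => digitRatio p e)
    (v := fun e => transPart p e) (fun e => digitRatio_ne_zero hp (hJ e.2))
    (fun e => abs_digitRatio_lt_one hp (hJ e.2)) hK
    (fun e => mapsTo_digit_openSquare hp (hJ e.2))
    (fun e e' hne => disjoint_digit_image hp (hJ e.2) (hJ e'.2) fun h => hne (Subtype.ext h))
    (sum_abs_digitRatio_mul_lt_one hp hJ) (one_le_sum_abs_digitRatio_zero hp h₀ h₁)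
    (fun x hx => exists_mem_limitSet_apply_eq hK subset_rfl
      (fun x hx => exists_digit_horizontal hp h₀ h₁ hx) (Ioo_subset_Icc_self hx)) ?_
  rcases hcase with ⟨h, -⟩ | h
  · exact Or.inl (sum_abs_digitRatio_one_lt_one fun e he =>
      ⟨(hJ he).1, h (mem_image_of_mem _ he)⟩)
  · refine Or.inr ⟨1 / 2, 1, by norm_num, by norm_num, le_rfl, fun y hy =>
      exists_mem_limitSet_apply_eq hK (Icc_subset_Icc_left (by norm_num))
        (fun y hy => exists_digit_vertical (h (by simp)) (h (by simp)) hy)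
        (Ioo_subset_Icc_self hy)⟩
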